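/- Theorem (Uniform Exponential Contraction). Let $M$ be a smooth Riemannian manifold of dimension $n$ (Hausdorff, without boundary) and let $f\colon M\to\mathbb{R}$ be a $C^2$-function whose gradient field $\nabla f$ is complete. Let $\phi_t\colon M\to M$, $t\in\mathbb{R}$, be its flow. Let $1\le k\le n$ be an integer and $\epsilon_k\in\mathbb{R}$ be such that $\operatorname{tr}_k(\nabla df)(x)\ge \epsilon_k$ for all $x\in M$, where $\nabla df$ is the Hessian of $f$ (for the Levi-Civita connection) and $\operatorname{tr}_k(A)=\lambda_1+\dots+\lambda_k$ for a symmetric bilinear form $A$ with eigenvalues $\lambda_1\le\dots\le\lambda_n$ (with multiplicity, with respect to the metric). Then $(\phi_t)_{t\in\mathbb{R}}$ is a one-parameter group of $C^1$-diffeomorphisms of $M$, and \[ \operatorname{Jac}_k\phi_{-t}(x)\le e^{-\epsilon_k t}\qquad\text{for all } t>0,\ x\in M, \] where $\operatorname{Jac}_k F(x)=\sup\|dF(e_1)\wedge\dots\wedge dF(e_k)\|$, the supremum being over the orthonormal $k$-frames $(e_1,\dots,e_k)$ of $T_xM$. In particular, if $\epsilon_k>0$, then $\phi_t$ uniformly exponentially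 expands and $\phi_{-t}$ uniformly exponentially contracts the $k$-volume as $t$ increases: for every $t>0$, every open $D\subseteq\mathbb{R}^k$ and every $C^1$-map $\sigma\colon D\to M$, with $\operatorname{vol}_k(\sigma)=\int_D\operatorname{Jac}_k\sigma(u)\,du\in[0,\infty]$, \[ \operatorname{vol}_k(\phi_t\circ\sigma)\ge e^{\epsilon_k t}\operatorname{vol}_k(\sigma)\qquad\text{and}\qquad \operatorname{vol}_k(\phi_{-t}\circ\sigma)\le e^{-\epsilon_k t}\operatorname{vol}_k(\sigma). \] -/

import Mathlib

open Manifold MeasureTheory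
open scoped ContDiff RealInnerProductSpace

noncomputable section

namespace GradFlow

section LinearAlgebra

variable {V : Type*} [NormedAddCommGroup V] [InnerProductSpace ℝ V] [FiniteDimensional ℝ V]

/-- The vector representing a linear form through the inner product. -/
def riesz (l : V →L[ℝ] ℝ) : V :=
  haveI := FiniteDimensional.complete ℝ V
  (InnerProductSpace.toDual ℝ V).symm l

theorem inner_riesz (l : V →L[ℝ] ℝ) (v : V) : ⟪riesz l, v⟫ = l v := by
  have := FiniteDimensional.complete ℝ V
  exact InnerProductSpace.toDual_symm_apply

theorem riesz_add (l l' : V →L[ℝ] ℝ) : riesz (l + l') = riesz l + riesz l' := by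
  simp [riesz]

theorem riesz_smul (c : ℝ) (l : V →L[ℝ] ℝ) : riesz (c • l) = c • riesz l := by
  simp [riesz]

/-- The endomorphism `T` of `V` associated with a bilinear form `A` through the inner product:
`⟪T u, v⟫ = A u v`. -/
def formOperator (A : LinearMap.BilinForm ℝ V) : V →ₗ[ℝ] V where
  toFun u := riesz (LinearMap.toContinuousLinearMap (A u))
  map_add' u v := by simp [riesz_add]
  map_smul' c u := by simp [riesz_smul]

theorem inner_formOperator (A : LinearMap.BilinForm ℝ V) (u v : V) :
    ⟪formOperator A u, v⟫ = A u v := by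
  simp [formOperator, inner_riesz]

/-- The `k`-trace of a symmetric bilinear form: list its eigenvalues with respect to the inner
product, with multiplicity, in increasing order, and add up the first `k` of them. -/
def traceK (k : ℕ) (A : LinearMap.BilinForm ℝ V) : ℝ :=
  (((formOperator A).charpoly.roots.sort (· ≤ ·)).take k).sum

end LinearAlgebra

section Chart

variable {E : Type*} [NormedAddCommGroup E] [NormedSpace ℝ E]

/-- The Christoffel symbols of the first kind at `y` of a Riemannian metric `G = (g_{ij})` on an
open subset of `E`: `w ↦ (∂_u g(v, w) + ∂_v g(u, w) - ∂_w g(u, v)) / 2`. -/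
def christoffelLower (G : E → E →L[ℝ] E →L[ℝ] ℝ) (y u v : E) : E →L[ℝ] ℝ :=
  (1 / 2 : ℝ) • (fderiv ℝ G y u v + fderiv ℝ G y v u - ((fderiv ℝ G y).flip u).flip v)

theorem christoffelLower_apply (G : E → E →L[ℝ] E →L[ℝ] ℝ) (y u v w : E) :
    christoffelLower G y u v w
      = (1 / 2 : ℝ) * (fderiv ℝ G y u v w + fderiv ℝ G y v u w - fderiv ℝ G y w u v) := by
  simp [christoffelLower]

theorem christoffelLower_add_left (G : E → E →L[ℝ] E →L[ℝ] ℝ) (y u u' v : E) :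
    christoffelLower G y (u + u') v = christoffelLower G y u v + christoffelLower G y u' v := by
  ext w
  simp [christoffelLower_apply]
  ring

theorem christoffelLower_smul_left (G : E → E →L[ℝ] E →L[ℝ] ℝ) (y : E) (c : ℝ) (u v : E) :
    christoffelLower G y (c • u) v = c • christoffelLower G y u v := by
  ext w
  simp [christoffelLower_apply]
  ring

theorem christoffelLower_add_right (G : E → E →L[ℝ] E →L[ℝ] ℝ) (y u v v' : E) :
    christoffelLower G y u (v + v') = christoffelLower G y u v + christoffelLower G y u v' := by
  ext w
  simp [christoffelLower_apply]
  ring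

theorem christoffelLower_smul_right (G : E → E →L[ℝ] E →L[ℝ] ℝ) (y : E) (c : ℝ) (u v : E) :
    christoffelLower G y u (c • v) = c • christoffelLower G y u v := by
  ext w
  simp [christoffelLower_apply]
  ring

/-- The second derivative at `y` of a function on an open subset of `E`. -/
def secondDeriv (h : E → ℝ) (y : E) : E →L[ℝ] E →L[ℝ] ℝ :=
  fderiv ℝ (fderiv ℝ h) y

end Chart

section Manifold

open Bundle

variable {E : Type*} [NormedAddCommGroup E] [NormedSpace ℝ E] [FiniteDimensional ℝ E]
  {M : Type*} [TopologicalSpace M] [ChartedSpace E M]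

instance tangentSpace_finiteDimensional (x : M) :
    FiniteDimensional ℝ (TangentSpace 𝓘(ℝ, E) x) :=
  inferInstanceAs (FiniteDimensional ℝ E)

section Jacobian

variable {F : Type*} [NormedAddCommGroup F] [NormedSpace ℝ F] [FiniteDimensional ℝ F]
  {N : Type*} [TopologicalSpace N] [ChartedSpace F N]
  [RiemannianBundle (fun x : M ↦ TangentSpace 𝓘(ℝ, E) x)]
  [RiemannianBundle (fun x : N ↦ TangentSpace 𝓘(ℝ, F) x)]

/-- The `k`-Jacobian of `h : M → N` at `x`: the supremum of `‖dh(e₁) ∧ ⋯ ∧ dh(e_k)‖` over the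
orthonormal `k`-frames `e₁, …, e_k` of `T_x M`, with the norm on the exterior power induced by
the Riemannian metric at `h x`. -/
def jacobianK (k : ℕ) (h : M → N) (x : M) : ℝ :=
  ⨆ e : {e : Fin k → TangentSpace 𝓘(ℝ, E) x // Orthonormal ℝ e},
    ‖exteriorPower.ιMulti ℝ k (fun i ↦ mfderiv 𝓘(ℝ, E) 𝓘(ℝ, F) h x (e.1 i))‖

/-- The `k`-volume of the parametrized `k`-surface `σ : D → N`, `D ⊆ ℝᵏ`: the integral over `D`
of the `k`-Jacobian of `σ`. -/
def volumeK (k : ℕ) (D : Set (EuclideanSpace ℝ (Fin k))) (σ : EuclideanSpace ℝ (Fin k) → N) :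
    ENNReal :=
  ∫⁻ u in D, ENNReal.ofReal (jacobianK (E := EuclideanSpace ℝ (Fin k)) (F := F) k σ u)

/-- `ψ_t` contracts `k`-volume uniformly exponentially, at rate `c`, as `t` increases. -/
def ContractsVolumeExponentially (k : ℕ) (c : ℝ) (ψ : ℝ → N → N) : Prop :=
  0 < c ∧ ∀ t : ℝ, 0 < t → ∀ (D : Set (EuclideanSpace ℝ (Fin k)))
    (σ : EuclideanSpace ℝ (Fin k) → N), IsOpen D →
    ContMDiffOn 𝓘(ℝ, EuclideanSpace ℝ (Fin k)) 𝓘(ℝ, F) 1 σ D →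
    volumeK (F := F) k D (ψ t ∘ σ) ≤ ENNReal.ofReal (Real.exp (-(c * t))) * volumeK (F := F) k D σ

/-- `ψ_t` expands `k`-volume uniformly exponentially, at rate `c`, as `t` increases. -/
def ExpandsVolumeExponentially (k : ℕ) (c : ℝ) (ψ : ℝ → N → N) : Prop :=
  0 < c ∧ ∀ t : ℝ, 0 < t → ∀ (D : Set (EuclideanSpace ℝ (Fin k)))
    (σ : EuclideanSpace ℝ (Fin k) → N), IsOpen D →
    ContMDiffOn 𝓘(ℝ, EuclideanSpace ℝ (Fin k)) 𝓘(ℝ, F) 1 σ D →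
    ENNReal.ofReal (Real.exp (c * t)) * volumeK (F := F) k D σ ≤ volumeK (F := F) k D (ψ t ∘ σ)

end Jacobian

section Flow

/-- A vector field is complete if through every point there passes an integral curve that is
defined for all times. -/
def IsCompleteField (X : (x : M) → TangentSpace 𝓘(ℝ, E) x) : Prop :=
  ∀ x : M, ∃ γ : ℝ → M, γ 0 = x ∧ IsMIntegralCurve γ X

/-- The flow `φ_t` of a complete vector field: `t ↦ φ_t(x)` is an integral curve that starts
at `x` (the only one, on a Hausdorff manifold without boundary and for a `C¹` field). -/
def flow (X : (x : M) → TangentSpace 𝓘(ℝ, E) x) (hX : IsCompleteField X) (t : ℝ) (x : M) : M :=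
  (hX x).choose t

end Flow

section Hessian

variable [RiemannianBundle (fun x : M ↦ TangentSpace 𝓘(ℝ, E) x)]

/-- The gradient `∇f`: `⟪∇f(x), v⟫ = df_x(v)`. -/
def grad (f : M → ℝ) (x : M) : TangentSpace 𝓘(ℝ, E) x :=
  riesz (mvfderiv 𝓘(ℝ, E) f x)

variable [IsManifold 𝓘(ℝ, E) ∞ M]

/-- The Riemannian metric in the chart `extChartAt x`: the matrix `g_{ij}(y)` as a bilinear form
on the model space `E`. Here `symmL ℝ p : E → T_p M` is the coordinate frame of the chart at `x`,
i.e. the derivative of the inverse chart. -/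
def chartMetric (x : M) (y : E) : E →L[ℝ] E →L[ℝ] ℝ :=
  let p : M := (extChartAt 𝓘(ℝ, E) x).symm y
  let L : E →L[ℝ] TangentSpace 𝓘(ℝ, E) p :=
    (trivializationAt E (TangentSpace 𝓘(ℝ, E)) x).symmL ℝ p
  (innerSL ℝ (E := TangentSpace 𝓘(ℝ, E) p)).bilinearComp L L

/-- The coordinates of tangent vectors at `x` in the chart at `x`. -/
def chartCoord (x : M) : TangentSpace 𝓘(ℝ, E) x →L[ℝ] E :=
  (trivializationAt E (TangentSpace 𝓘(ℝ, E)) x).continuousLinearMapAt ℝ x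

/-- The Christoffel symbols `Γ(u, v) = u^i v^j Γ_{ij}^k ∂_k` of the Levi-Civita connection at `x`
in the chart at `x`, for `u`, `v` given in coordinates. -/
def christoffel (x : M) (u v : E) : TangentSpace 𝓘(ℝ, E) x :=
  riesz ((christoffelLower (chartMetric x) (extChartAt 𝓘(ℝ, E) x x) u v).comp (chartCoord x))

theorem christoffel_add_left (x : M) (u u' v : E) :
    christoffel x (u + u') v = christoffel x u v + christoffel x u' v := by
  rw [christoffel, christoffelLower_add_left, ContinuousLinearMap.add_comp]
  exact riesz_add _ _

theorem christoffel_smul_left (x : M) (c : ℝ) (u v : E) :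
    christoffel x (c • u) v = c • christoffel x u v := by
  rw [christoffel, christoffelLower_smul_left, ContinuousLinearMap.smul_comp]
  exact riesz_smul _ _

theorem christoffel_add_right (x : M) (u v v' : E) :
    christoffel x u (v + v') = christoffel x u v + christoffel x u v' := by
  rw [christoffel, christoffelLower_add_right, ContinuousLinearMap.add_comp]
  exact riesz_add _ _

theorem christoffel_smul_right (x : M) (c : ℝ) (u v : E) :
    christoffel x u (c • v) = c • christoffel x u v := by
  rw [christoffel, christoffelLower_smul_right, ContinuousLinearMap.smul_comp]
  exact riesz_smul _ _

/-- The Hessian `∇df` of `f` at `x` for the Levi-Civita connection, in the coordinates of the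
chart at `x`: `∇df(∂_i, ∂_j) = ∂_i ∂_j f - df(Γ_{ij}^k ∂_k)`. -/
def hessian (f : M → ℝ) (x : M) : LinearMap.BilinForm ℝ (TangentSpace 𝓘(ℝ, E) x) :=
  LinearMap.mk₂ ℝ
    (fun u v ↦
      secondDeriv (f ∘ (extChartAt 𝓘(ℝ, E) x).symm) (extChartAt 𝓘(ℝ, E) x x)
          (chartCoord x u) (chartCoord x v)
        - mvfderiv 𝓘(ℝ, E) f x (christoffel x (chartCoord x u) (chartCoord x v)))
    (fun u u' v ↦ by
      simp only [map_add, christoffel_add_left, add_apply]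
      ring)
    (fun c u v ↦ by
      simp only [map_smul, christoffel_smul_left, smul_apply, smul_eq_mul]
      ring)
    (fun u v v' ↦ by
      simp only [map_add, christoffel_add_right]
      ring)
    (fun c u v ↦ by
      simp only [map_smul, christoffel_smul_right, smul_eq_mul]
      ring)

theorem hessian_apply (f : M → ℝ) (x : M) (u v : TangentSpace 𝓘(ℝ, E) x) :
    hessian f x u v
      = secondDeriv (f ∘ (extChartAt 𝓘(ℝ, E) x).symm) (extChartAt 𝓘(ℝ, E) x x)
          (chartCoord x u) (chartCoord x v)
        - mvfderiv 𝓘(ℝ, E) f x (christoffel x (chartCoord x u) (chartCoord x v)) :=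
  rfl

end Hessian

end Manifold

end GradFlow

end

open Bundle

/-! The flow changes the metric at the rate of its Lie derivative, and for a gradient field this is
twice the Hessian (`lieDeriv_chartMetric_grad`). For tangent vectors `v₁, …, v_k` at `x`, let `D(t)`
be the Gram determinant of their images under `dφ_t`, that is, the square of the `k`-volume they
span. If the vectors are orthonormal, Jacobi's formula gives `D'(0) = 2 ∑ᵢ ∇df(vᵢ, vᵢ)`, and Ky
Fan's inequality `traceK_le_sum` bounds this below by `2 tr_k(∇df) ≥ 2ε`. A change of frame
multiplies `D` by a constant square, so `D'(0) ≥ 2ε D(0)` for every tuple, and the group law carries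
this to `D' ≥ 2ε D` at all times. Hence `e^{-2εt} D(t)` is monotone. Comparing the times `-t` and
`0` bounds the `k`-Jacobian of `φ_{-t}`, and integration over a surface gives the contraction of
volumes. Expansion under `φ_t` is contraction under `φ_{-t}` of the surface `φ_t ∘ σ`.

The analytic input is the dependence of the flow on the initial point. Since `f` is only `C²`, its
gradient is only `C¹`, and the first variation needs the time derivative of `dφ_t` at `0` to exist
and to be the derivative of the field. Both come from solving `u = x + τ ∫ X ∘ u` in a Banach space
of continuous curves by the inverse function theorem (`exists_contDiffAt_solution`,
`exists_local_flow`). Uniqueness of integral curves identifies this local solution with the global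
flow (`exists_flow_eq_chart`). -/

namespace GradFlow

/-! ### Ky Fan's inequality, and Gram determinants as squared `k`-volumes -/

section LinearAlgebra

variable {V : Type*} [NormedAddCommGroup V] [InnerProductSpace ℝ V]

/-- Among all weights in `[0, 1]` of total mass `k`, the sum of a sorted list is smallest for the
indicator of its first `k` entries. -/
theorem sum_take_le_weighted_sum {ι : Type*} [Fintype ι] (μ w : ι → ℝ) (l : List ℝ)
    (hl : l.Pairwise (· ≤ ·)) (hμ : (l : Multiset ℝ) = Finset.univ.val.map μ)
    (hw0 : ∀ j, 0 ≤ w j) (hw1 : ∀ j, w j ≤ 1) (k : ℕ) (hk : 1 ≤ k) (hkl : k ≤ l.length)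
    (hw : ∑ j, w j = k) : (l.take k).sum ≤ ∑ j, w j * μ j := by
  -- The threshold `c` is the `k`-th smallest entry, at index `k - 1`. After subtracting it, the
  -- first `k` entries are nonpositive and the others nonnegative, so a weight in `[0, 1]` cannot
  -- push a term below `min (μ j - c) 0`. The shift costs `k * c` on both sides, because the total
  -- mass is `k`.
  obtain ⟨c, hc1, hc2⟩ : ∃ c, (∀ x ∈ l.take k, x ≤ c) ∧ ∀ x ∈ l.drop k, c ≤ x := by
    refine ⟨l[k - 1], fun x hx ↦ ?_, fun x hx ↦ ?_⟩
    · obtain ⟨i, hi, rfl⟩ := List.mem_iff_getElem.1 hx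
      rw [List.length_take] at hi
      rw [List.getElem_take]
      rcases (show i ≤ k - 1 by omega).lt_or_eq with h | h
      · exact List.pairwise_iff_getElem.1 hl _ _ _ _ h
      · simp [h]
    · obtain ⟨i, hi, rfl⟩ := List.mem_iff_getElem.1 hx
      rw [List.getElem_drop]
      exact List.pairwise_iff_getElem.1 hl _ _ _ _ (by omega)
  have h1 : ∑ j, w j * μ j = ∑ j, w j * (μ j - c) + k * c := by
    rw [← hw, Finset.sum_mul, ← Finset.sum_add_distrib]
    exact Finset.sum_congr rfl fun j _ ↦ by ring
  have h2 : ∑ j, min (μ j - c) 0 ≤ ∑ j, w j * (μ j - c) := by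
    refine Finset.sum_le_sum fun j _ ↦ ?_
    rcases le_total (μ j - c) 0 with h | h
    · rw [min_eq_left h]
      nlinarith [hw1 j]
    · rw [min_eq_right h]
      exact mul_nonneg (hw0 j) h
  have h3 : ∑ j, min (μ j - c) 0 = (l.map fun x ↦ min (x - c) 0).sum := by
    have := congrArg (fun s : Multiset ℝ ↦ (s.map fun x ↦ min (x - c) 0).sum) hμ
    simp only [Multiset.map_map, Multiset.map_coe, Multiset.sum_coe] at this
    rw [this]
    rfl
  have h4 : (l.map fun x ↦ min (x - c) 0).sum = (l.take k).sum - k * c := by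
    conv_lhs => rw [← List.take_append_drop k l]
    rw [List.map_append, List.sum_append]
    have h5 : ((l.take k).map fun x ↦ min (x - c) 0) = (l.take k).map fun x ↦ x - c :=
      List.map_congr_left fun x hx ↦ min_eq_left (sub_nonpos.2 (hc1 x hx))
    have h6 : ((l.drop k).map fun x ↦ min (x - c) 0) = (l.drop k).map fun _ ↦ (0 : ℝ) :=
      List.map_congr_left fun x hx ↦ min_eq_right (sub_nonneg.2 (hc2 x hx))
    have h7 : ∀ m : List ℝ, (m.map fun x ↦ x - c).sum = m.sum - m.length * c := by
      intro m
      induction m with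
      | nil => simp
      | cons a m ih =>
        simp only [List.map_cons, List.sum_cons, ih, List.length_cons]
        push_cast
        ring
    rw [h5, h6, h7]
    simp [hkl]
  linarith

/-- Ky Fan: the `k`-trace bounds the trace over every orthonormal `k`-frame from below. -/
theorem traceK_le_sum [FiniteDimensional ℝ V] (A : LinearMap.BilinForm ℝ V)
    (hA : ∀ u v, A u v = A v u) {k : ℕ} (hk : 1 ≤ k) {e : Fin k → V} (he : Orthonormal ℝ e) :
    traceK k A ≤ ∑ i, A (e i) (e i) := by
  have hT : (formOperator A).IsSymmetric := fun u v ↦ by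
    rw [inner_formOperator, hA, real_inner_comm, inner_formOperator]
  have hkn : k ≤ Module.finrank ℝ V := by
    simpa using he.linearIndependent.fintype_card_le_finrank
  set b := hT.eigenvectorBasis rfl
  set μ := hT.eigenvalues rfl
  -- Expansion in an eigenbasis. The weight of `μ j` is at most `1` by Bessel's inequality for the
  -- unit vector `b j`, and the weights add up to `k` by Parseval's identity for each `e i`.
  have key : ∑ i, A (e i) (e i) = ∑ j, (∑ i, ⟪e i, b j⟫ ^ 2) * μ j := by
    simp_rw [Finset.sum_mul]
    rw [Finset.sum_comm]
    refine Finset.sum_congr rfl fun i _ ↦ ?_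
    rw [← inner_formOperator, ← b.sum_inner_mul_inner]
    refine Finset.sum_congr rfl fun j _ ↦ ?_
    rw [hT, hT.apply_eigenvectorBasis, inner_smul_right, real_inner_comm (e i) (b j)]
    simp only [RCLike.ofReal_real_eq_id, id]
    ring
  rw [key, traceK]
  refine sum_take_le_weighted_sum μ _ _ (Multiset.pairwise_sort _ _) ?_
    (fun j ↦ Finset.sum_nonneg fun i _ ↦ sq_nonneg _) (fun j ↦ ?_) k hk ?_ ?_
  · rw [Multiset.sort_eq, hT.roots_charpoly_eq_eigenvalues rfl]
    rfl
  · have := he.sum_inner_products_le (x := b j) (s := Finset.univ)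
    simpa using this
  · rw [Multiset.length_sort, hT.roots_charpoly_eq_eigenvalues rfl]
    simpa using hkn
  · rw [Finset.sum_comm]
    have (i : Fin k) : ∑ j, ⟪e i, b j⟫ ^ 2 = 1 := by
      have := b.sum_sq_norm_inner_left (e i)
      simpa [he.1 i] using this
    simp [this]

theorem norm_ιMulti_sq [FiniteDimensional ℝ V] {k : ℕ} (v : Fin k → V) :
    ‖exteriorPower.ιMulti ℝ k v‖ ^ 2 = (Matrix.gram ℝ v).det := by
  rw [← real_inner_self_eq_norm_sq, exteriorPower.inner_ιMulti_self]

theorem det_gram_sum_smul {k : ℕ} (P : Matrix (Fin k) (Fin k) ℝ) (e : Fin k → V) :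
    (Matrix.gram ℝ fun i ↦ ∑ j, P i j • e j).det = P.det ^ 2 * (Matrix.gram ℝ e).det := by
  have : (Matrix.gram ℝ fun i ↦ ∑ j, P i j • e j) = P * Matrix.gram ℝ e * P.transpose := by
    ext i j
    simp only [Matrix.gram_apply, Matrix.mul_apply, sum_inner, inner_sum, Matrix.transpose_apply,
      Finset.sum_mul, real_inner_smul_left, real_inner_smul_right]
    refine Finset.sum_congr rfl fun a _ ↦ Finset.sum_congr rfl fun c _ ↦ ?_
    ring
  rw [this, Matrix.det_mul, Matrix.det_mul, Matrix.det_transpose]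
  ring

/-- A linearly independent family is obtained from an orthonormal one by a square matrix. -/
theorem exists_orthonormal_sum_smul {k : ℕ} {v : Fin k → V} (hv : LinearIndependent ℝ v) :
    ∃ (e : Fin k → V) (P : Matrix (Fin k) (Fin k) ℝ), Orthonormal ℝ e ∧
      v = fun i ↦ ∑ j, P i j • e j := by
  refine ⟨InnerProductSpace.gramSchmidtNormed ℝ v, ?_⟩
  have h (i : Fin k) :
      ∃ c : Fin k → ℝ, ∑ j, c j • InnerProductSpace.gramSchmidtNormed ℝ v j = v i := by
    rw [← Submodule.mem_span_range_iff_exists_fun, InnerProductSpace.span_gramSchmidtNormed_range,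
      InnerProductSpace.span_gramSchmidt]
    exact Submodule.subset_span ⟨i, rfl⟩
  choose P hP using h
  exact ⟨P, InnerProductSpace.gramSchmidtNormed_orthonormal hv, funext fun i ↦ (hP i).symm⟩

variable {W : Type*} [NormedAddCommGroup W] [InnerProductSpace ℝ W]

theorem det_gram_eq_zero_of_not_linearIndependent {k : ℕ} {v : Fin k → V}
    (hv : ¬LinearIndependent ℝ v) (T : V →ₗ[ℝ] W) :
    (Matrix.gram ℝ fun i ↦ T (v i)).det = 0 := by
  by_contra h
  exact hv (LinearIndependent.of_comp T (Matrix.linearIndependent_of_det_gram_ne_zero h))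

theorem det_gram_map_sum_smul {k : ℕ} (P : Matrix (Fin k) (Fin k) ℝ) (e : Fin k → V)
    (T : V →ₗ[ℝ] W) :
    (Matrix.gram ℝ fun i ↦ T (∑ j, P i j • e j)).det
      = P.det ^ 2 * (Matrix.gram ℝ fun i ↦ T (e i)).det := by
  simp_rw [map_sum, map_smul]
  exact det_gram_sum_smul P fun j ↦ T (e j)

/-- A bound on the `k`-volume distortion of orthonormal frames holds for all `k`-tuples. -/
theorem norm_ιMulti_map_le [FiniteDimensional ℝ V] [FiniteDimensional ℝ W] {k : ℕ}
    (T : V →ₗ[ℝ] W) {c : ℝ} (hc : 0 ≤ c)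
    (h : ∀ e : Fin k → V, Orthonormal ℝ e → ‖exteriorPower.ιMulti ℝ k fun i ↦ T (e i)‖ ≤ c)
    (v : Fin k → V) :
    ‖exteriorPower.ιMulti ℝ k fun i ↦ T (v i)‖ ≤ c * ‖exteriorPower.ιMulti ℝ k v‖ := by
  refine abs_le_of_sq_le_sq' ?_ (by positivity) |>.2
  rw [mul_pow, norm_ιMulti_sq, norm_ιMulti_sq]
  by_cases hv : LinearIndependent ℝ v
  -- Passing to an orthonormal frame takes the same factor `P.det ^ 2` out of both Gram
  -- determinants.
  · obtain ⟨e, P, he, rfl⟩ := exists_orthonormal_sum_smul hv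
    rw [det_gram_map_sum_smul, det_gram_sum_smul, Matrix.gram_eq_one_iff_orthonormal.2 he,
      Matrix.det_one, mul_one, mul_comm, ← norm_ιMulti_sq]
    gcongr
    exact h e he
  · rw [det_gram_eq_zero_of_not_linearIndependent hv]
    exact mul_nonneg (sq_nonneg c) (norm_ιMulti_sq v ▸ sq_nonneg _)

/-- The norms of the images of orthonormal `k`-frames are bounded. -/
theorem bddAbove_norm_ιMulti_map [FiniteDimensional ℝ V] [FiniteDimensional ℝ W] (k : ℕ)
    (T : V →ₗ[ℝ] W) :
    BddAbove (Set.range fun e : {e : Fin k → V // Orthonormal ℝ e} ↦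
      ‖exteriorPower.ιMulti ℝ k fun i ↦ T (e.1 i)‖) := by
  have hT (e : {e : Fin k → V // Orthonormal ℝ e}) (i : Fin k) :
      ‖T (e.1 i)‖ ≤ ‖LinearMap.toContinuousLinearMap T‖ := by
    simpa [e.2.1 i] using (LinearMap.toContinuousLinearMap T).le_opNorm (e.1 i)
  set C := ‖LinearMap.toContinuousLinearMap T‖
  refine ⟨√((Nat.factorial k : ℝ) * (C * C) ^ k), ?_⟩
  rintro _ ⟨e, rfl⟩
  refine Real.le_sqrt_of_sq_le ?_
  rw [norm_ιMulti_sq]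
  -- A crude bound suffices: the Leibniz expansion has `k!` terms, and every Gram entry is at most
  -- `C * C`.
  have h := Matrix.det_le (A := Matrix.gram ℝ fun i ↦ T (e.1 i)) (abv := AbsoluteValue.abs)
    (x := C * C) fun i j ↦ (abs_real_inner_le_norm _ _).trans
      (mul_le_mul (hT e i) (hT e j) (norm_nonneg _) (norm_nonneg _))
  simpa [nsmul_eq_mul] using (le_abs_self _).trans h

end LinearAlgebra

end GradFlow

namespace GradFlow

/-! ### Superposition operators and the integral equation of the flow -/

section LocalFlow

open Set Filter Topology

variable {E F : Type*} [NormedAddCommGroup E] [NormedSpace ℝ E]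
  [NormedAddCommGroup F] [NormedSpace ℝ F]

/-- Pointwise application of a continuous bilinear map to continuous maps. -/
noncomputable def pointwiseBilin {G : Type*} [NormedAddCommGroup G] [NormedSpace ℝ G]
    (B : G →L[ℝ] E →L[ℝ] F) (K : Type*) [TopologicalSpace K] [CompactSpace K] :
    C(K, G) →L[ℝ] C(K, E) →L[ℝ] C(K, F) :=
  LinearMap.mkContinuous₂
    (LinearMap.mk₂ ℝ (fun (A : C(K, G)) (u : C(K, E)) ↦
        (⟨fun s ↦ B (A s) (u s), by fun_prop⟩ : C(K, F)))
      (fun A A' u ↦ by ext; simp) (fun c A u ↦ by ext; simp)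
      (fun A u v ↦ by ext; simp) (fun c A u ↦ by ext; simp)) ‖B‖ fun A u ↦ by
    rw [ContinuousMap.norm_le _ (by positivity)]
    refine fun s ↦ (B.le_opNorm₂ _ _).trans ?_
    have := A.norm_coe_le_norm s
    have := u.norm_coe_le_norm s
    gcongr

/-- Pointwise application of a continuous family of linear maps to continuous maps. -/
noncomputable def pointwiseApply (K : Type*) [TopologicalSpace K] [CompactSpace K] :
    C(K, E →L[ℝ] F) →L[ℝ] C(K, E) →L[ℝ] C(K, F) :=
  pointwiseBilin (ContinuousLinearMap.id ℝ (E →L[ℝ] F)) K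

/-- The superposition operator of a `C¹` map is Fréchet differentiable. -/
theorem hasFDerivAt_continuousMap_comp {K : Type*} [TopologicalSpace K] [CompactSpace K]
    (X : C(E, F)) (X' : C(E, E →L[ℝ] F)) (hX : ∀ x, HasFDerivAt X (X' x) x) (u : C(K, E)) :
    HasFDerivAt (fun u : C(K, E) ↦ X.comp u) (pointwiseApply K (X'.comp u)) u := by
  rw [hasFDerivAt_iff_isLittleO_nhds_zero, Asymptotics.isLittleO_iff]
  intro c hc
  have hK : IsCompact (range u) := isCompact_range u.continuous
  -- Continuity of `X'` is uniform near the compact range of `u`. One `δ` therefore serves for all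
  -- `s` in the mean value estimate, which makes the remainder small in the sup norm.
  have hunif := hK.uniformContinuousAt_of_continuousAt X' (fun x _ ↦ X'.continuous.continuousAt)
    (Metric.dist_mem_uniformity hc)
  obtain ⟨δ, hδ, hunif⟩ := Metric.mem_uniformity_dist.1 hunif
  filter_upwards [Metric.ball_mem_nhds (0 : C(K, E)) hδ] with h hh
  rw [mem_ball_zero_iff] at hh
  rw [ContinuousMap.norm_le _ (by positivity)]
  intro s
  have hs : ‖h s‖ ≤ ‖h‖ := h.norm_coe_le_norm s
  have key := (convex_ball (u s) δ).norm_image_sub_le_of_norm_hasFDerivWithin_le'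
    (f := X) (f' := X') (φ := X' (u s)) (C := c) (x := u s) (y := u s + h s)
    (fun x _ ↦ (hX x).hasFDerivWithinAt) (fun x hx ↦ ?_) (Metric.mem_ball_self hδ)
    (by simpa using hs.trans_lt hh)
  · simp only [add_sub_cancel_left] at key
    change ‖X (u s + h s) - X (u s) - (X' (u s)) (h s)‖ ≤ c * ‖h‖
    exact key.trans (mul_le_mul_of_nonneg_left hs hc.le)
  · have := @hunif (u s) x (by rwa [dist_comm]) (mem_range_self s)
    rw [← dist_eq_norm, dist_comm]
    exact this.le

/-- The superposition operator of a `C¹` map is `C¹`. -/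
theorem contDiff_continuousMap_comp {K : Type*} [TopologicalSpace K] [CompactSpace K]
    (X : C(E, F)) (hX : ContDiff ℝ 1 X) : ContDiff ℝ 1 fun u : C(K, E) ↦ X.comp u := by
  let X' : C(E, E →L[ℝ] F) := ⟨fderiv ℝ X, hX.continuous_fderiv one_ne_zero⟩
  have h := hasFDerivAt_continuousMap_comp (K := K) X X'
    fun x ↦ (hX.differentiable one_ne_zero x).hasFDerivAt
  rw [contDiff_one_iff_fderiv]
  refine ⟨fun u ↦ (h u).differentiableAt, ?_⟩
  rw [show fderiv ℝ (fun u : C(K, E) ↦ X.comp u) = fun u ↦ pointwiseApply K (X'.comp u) from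
    funext fun u ↦ (h u).fderiv]
  exact (pointwiseApply K).continuous.comp (ContinuousMap.continuous_postcomp X')

/-- The primitive `s ↦ ∫₀ˢ u` of continuous functions on `[-2, 2]`. -/
noncomputable def primitive : C(Icc (-2 : ℝ) 2, E) →L[ℝ] C(Icc (-2 : ℝ) 2, E) :=
  LinearMap.mkContinuous
    { toFun u := ⟨fun s ↦ ∫ r in (0 : ℝ)..s, IccExtend (by norm_num) u r, by
        have : Continuous fun s : ℝ ↦ ∫ r in (0 : ℝ)..s, IccExtend (by norm_num) u r :=
          intervalIntegral.continuous_primitive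
            (fun a b ↦ (u.continuous.Icc_extend').intervalIntegrable a b) 0
        exact this.comp continuous_subtype_val⟩
      map_add' u v := by
        ext s
        exact intervalIntegral.integral_add (u.continuous.Icc_extend'.intervalIntegrable _ _)
          (v.continuous.Icc_extend'.intervalIntegrable _ _)
      map_smul' c u := by
        ext s
        exact intervalIntegral.integral_smul c _ } 2 fun u ↦ by
    rw [ContinuousMap.norm_le _ (by positivity)]
    intro s
    refine (intervalIntegral.norm_integral_le_of_norm_le_const (C := ‖u‖)
      fun r _ ↦ u.norm_coe_le_norm _).trans ?_
    rw [sub_zero, mul_comm]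
    exact mul_le_mul_of_nonneg_right (abs_le.2 ⟨s.2.1, s.2.2⟩) (norm_nonneg _)

/-- Integral equation `u = x + τ ∫ X ∘ u` solved for `u`, in dependence on `(τ, x)`. -/
theorem exists_contDiffAt_solution [CompleteSpace E] (X : C(E, E)) (hX : ContDiff ℝ 1 X) (x₀ : E) :
    ∃ S : ℝ × E → C(Icc (-2 : ℝ) 2, E), ContDiffAt ℝ 1 S (0, x₀) ∧
      S (0, x₀) = ContinuousMap.const _ x₀ ∧
      ∀ᶠ p in 𝓝 (0, x₀), S p = ContinuousMap.const _ p.2 + p.1 • primitive (X.comp (S p)) := by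
  let B := C(Icc (-2 : ℝ) 2, E)
  let N : B → B := fun u ↦ primitive (X.comp u)
  have hN : ContDiff ℝ 1 N := primitive.contDiff.comp (contDiff_continuousMap_comp X hX)
  -- The integral equation reads `G (τ, u) = (τ, const x)`. At `τ = 0` the term containing the
  -- derivative of `N` vanishes, so the derivative of `G` is the triangular map `(τ, u) ↦ (τ, u - τ
  -- N(c x₀))`. It is invertible with no smallness condition on `X`.
  let G : ℝ × B → ℝ × B := fun q ↦ (q.1, q.2 - q.1 • N q.2)
  have hG : ContDiff ℝ 1 G := contDiff_fst.prodMk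
    (contDiff_snd.sub (contDiff_fst.smul (hN.comp contDiff_snd)))
  let c : E →L[ℝ] B := ContinuousLinearMap.const ℝ _
  let G' : (ℝ × B) ≃L[ℝ] (ℝ × B) := (ContinuousLinearEquiv.refl ℝ ℝ).skewProd
    (ContinuousLinearEquiv.refl ℝ B) (-ContinuousLinearMap.toSpanSingleton ℝ (N (c x₀)))
  have hG' : HasFDerivAt G (G' : ℝ × B →L[ℝ] ℝ × B) (0, c x₀) := by
    have h1 : HasFDerivAt (fun q : ℝ × B ↦ N q.2) _ (0, c x₀) :=
      HasFDerivAt.comp (g := N) (0, c x₀) (hN.differentiable one_ne_zero (c x₀)).hasFDerivAt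
        (hasFDerivAt_snd (𝕜 := ℝ) (p := ((0 : ℝ), c x₀)))
    have h2 := (hasFDerivAt_fst (𝕜 := ℝ) (p := ((0 : ℝ), c x₀))).prodMk
      ((hasFDerivAt_snd (𝕜 := ℝ) (p := ((0 : ℝ), c x₀))).sub
      ((hasFDerivAt_fst (𝕜 := ℝ) (p := ((0 : ℝ), c x₀))).smul h1))
    refine h2.congr_fderiv ?_
    ext q <;> simp [G']
  have hGc : G (0, c x₀) = (0, c x₀) := by simp [G]
  have hGx : ContDiffAt ℝ 1 G (0, c x₀) := hG.contDiffAt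
  let R := hGx.localInverse hG' one_ne_zero
  have hR : ContDiffAt ℝ 1 R (0, c x₀) := hGc ▸ hGx.to_localInverse hG' one_ne_zero
  have hRc : R (0, c x₀) = (0, c x₀) := by
    have := hGx.localInverse_apply_image hG' one_ne_zero
    rwa [hGc] at this
  have hRG : ∀ᶠ q in 𝓝 (0, c x₀), G (R q) = q := by
    have := (hGx.hasStrictFDerivAt' hG' one_ne_zero).eventually_right_inverse
    rwa [hGc] at this
  have hι : ContDiff ℝ 1 fun p : ℝ × E ↦ (p.1, c p.2) :=
    contDiff_fst.prodMk (c.contDiff.comp contDiff_snd)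
  refine ⟨fun p ↦ (R (p.1, c p.2)).2, ?_, ?_, ?_⟩
  · exact contDiffAt_snd.comp (0, x₀)
      (ContDiffAt.comp (f := fun p : ℝ × E ↦ (p.1, c p.2)) (0, x₀) hR hι.contDiffAt)
  · simp only [hRc]
    rfl
  · have hcont := hι.continuous.tendsto (0, x₀)
    filter_upwards [hcont.eventually hRG] with p hp
    obtain ⟨h1, h2⟩ := Prod.ext_iff.1 hp
    simp only [G, N] at h1 h2
    rw [h1, sub_eq_iff_eq_add] at h2
    exact h2

end LocalFlow

end GradFlow

namespace GradFlow

/-! ### The local flow of a `C¹` field and its linearisation -/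

section LocalFlow

open Set Filter Topology

variable {E F : Type*} [NormedAddCommGroup E] [NormedSpace ℝ E]
  [NormedAddCommGroup F] [NormedSpace ℝ F]

/-- A map that is `C¹` near a point agrees near that point with a global `C¹` map. -/
theorem exists_contDiff_eventuallyEq [FiniteDimensional ℝ E] {X : E → F} {x₀ : E}
    (hX : ContDiffAt ℝ 1 X x₀) : ∃ Y : E → F, ContDiff ℝ 1 Y ∧ Y =ᶠ[𝓝 x₀] X := by
  obtain ⟨r, hr, hXr⟩ := Metric.eventually_nhds_iff_ball.1 (hX.eventually (by simp))
  -- The outer radius `r / 2` keeps the closed support inside the ball of radius `r` where `X` is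
  -- `C¹`.
  let χ : ContDiffBump x₀ := ⟨r / 4, r / 2, by positivity, by linarith⟩
  refine ⟨fun x ↦ χ x • X x, contDiff_iff_contDiffAt.2 fun x ↦ ?_, ?_⟩
  · by_cases hx : x ∈ Metric.ball x₀ r
    · exact χ.contDiff.contDiffAt.smul (hXr x hx)
    · have hx' : x ∉ tsupport χ := by
        rw [χ.tsupport_eq]
        intro h
        exact hx (Metric.closedBall_subset_ball (show r / 2 < r by linarith) h)
      refine contDiffAt_const (c := (0 : F)) |>.congr_of_eventuallyEq ?_
      filter_upwards [notMem_tsupport_iff_eventuallyEq.1 hx'] with y hy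
      simp [hy]
  · filter_upwards [χ.eventuallyEq_one] with x hx
    simp [hx]

/-- The difference quotient at `0` is `c τ` itself, so the product rule is not needed and `c` need
not be differentiable. In `exists_local_flow` the factor `c` is a partial derivative of a `C¹` map,
hence only continuous. -/
theorem hasDerivAt_smul_of_continuousAt {c : ℝ → F} (hc : ContinuousAt c 0) :
    HasDerivAt (fun τ : ℝ ↦ τ • c τ) (c 0) 0 := by
  rw [hasDerivAt_iff_tendsto_slope]
  refine (hc.tendsto.mono_left nhdsWithin_le_nhds).congr' ?_
  filter_upwards [self_mem_nhdsWithin] with τ (hτ : τ ≠ 0)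
  simp [slope, smul_smul, hτ]

/-- The local flow of a `C¹` vector field `X` near `x₀`: `Φ (τ, x) s` is the flow line through `x`
at time `τ s`. It is `C¹` in the initial point, and its derivative is the flow of the linearised
equation. -/
theorem exists_local_flow [FiniteDimensional ℝ E] {X : E → E} {x₀ : E}
    (hX : ContDiffAt ℝ 1 X x₀) : ∃ Φ : ℝ × E → ℝ → E,
      ContDiffAt ℝ 1 (fun p ↦ Φ p 1) (0, x₀) ∧
      (∀ W ∈ 𝓝 x₀, ∀ᶠ p in 𝓝 (0, x₀), Φ p 0 = p.2 ∧ ∀ s ∈ Ioo (-2 : ℝ) 2, Φ p s ∈ W ∧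
        HasDerivAt (Φ p) (p.1 • X (Φ p s)) s) ∧
      HasDerivAt (fun τ ↦ fderiv ℝ (fun x ↦ Φ (τ, x) 1) x₀) (fderiv ℝ X x₀) 0 := by
  have := FiniteDimensional.complete ℝ E
  obtain ⟨Y, hY, hYX⟩ := exists_contDiff_eventuallyEq hX
  let Yc : C(E, E) := ⟨Y, hY.continuous⟩
  obtain ⟨S, hS, hS0, hSeq⟩ := exists_contDiffAt_solution Yc hY x₀
  have hI : (-2 : ℝ) ≤ 2 := by norm_num
  let ev : C(Icc (-2 : ℝ) 2, E) →L[ℝ] E :=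
    ContinuousMap.evalCLM ℝ (⟨1, by norm_num⟩ : Icc (-2 : ℝ) 2)
  let h : ℝ × E → E := fun p ↦ ev (primitive (Yc.comp (S p)))
  have hh : ContDiffAt ℝ 1 h (0, x₀) := by
    have : ContDiffAt ℝ 1 (fun p ↦ Yc.comp (S p)) (0, x₀) :=
      (contDiff_continuousMap_comp Yc hY).contDiffAt.comp (0, x₀) hS
    exact this.continuousLinearMap_comp (ev.comp primitive)
  -- The right side of the integral equation, in place of `S p` itself. It is defined for every real
  -- `s`, its `s`-derivative is the fundamental theorem of calculus, and at `s = 1` it splits off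
  -- the factor `τ`.
  let Φ : ℝ × E → ℝ → E := fun p s ↦
    p.2 + p.1 • ∫ r in (0 : ℝ)..s, IccExtend hI (Yc.comp (S p)) r
  have hΦ1 (p : ℝ × E) : Φ p 1 = p.2 + p.1 • h p := rfl
  refine ⟨Φ, ?_, fun W hW ↦ ?_, ?_⟩
  · simp only [hΦ1]
    exact contDiffAt_snd.add (contDiffAt_fst.smul hh)
  · obtain ⟨r, hr, hWr⟩ := Metric.mem_nhds_iff.1 (inter_mem hW hYX)
    have hnear : ∀ᶠ p in 𝓝 (0, x₀), dist (S p) (ContinuousMap.const _ x₀) < r := by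
      have := hS.continuousAt.tendsto
      rw [hS0] at this
      exact this.eventually (Metric.ball_mem_nhds _ hr)
    filter_upwards [hSeq, hnear] with p hp hpr
    refine ⟨by simp [Φ], fun s hs ↦ ?_⟩
    have hsI : s ∈ Icc (-2 : ℝ) 2 := Ioo_subset_Icc_self hs
    have hval : Φ p s = S p ⟨s, hsI⟩ := by
      conv_rhs => rw [hp]
      rfl
    have hmem := hWr (show Φ p s ∈ Metric.ball x₀ r by
      rw [hval]
      exact (ContinuousMap.dist_apply_le_dist (f := S p) (g := ContinuousMap.const _ x₀) _).trans_lt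
        hpr)
    refine ⟨hmem.1, ?_⟩
    have hYs : IccExtend hI (Yc.comp (S p)) s = X (Φ p s) := by
      rw [IccExtend_of_mem _ _ hsI, hval, ← hval, ← show Y (Φ p s) = X (Φ p s) from hmem.2, hval]
      rfl
    have hcont : Continuous (IccExtend hI (Yc.comp (S p))) :=
      (Yc.comp (S p)).continuous.Icc_extend'
    have hd := (intervalIntegral.integral_hasDerivAt_right (hcont.intervalIntegrable 0 s)
      hcont.stronglyMeasurable.stronglyMeasurableAtFilter hcont.continuousAt)
    rw [hYs] at hd
    exact (hd.const_smul p.1).const_add p.2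
  · have hinr (τ : ℝ) : HasFDerivAt (fun x : E ↦ (τ, x)) (ContinuousLinearMap.inr ℝ ℝ E) x₀ :=
      hasFDerivAt_prodMk_right τ x₀
    let c : ℝ → E →L[ℝ] E := fun τ ↦ (fderiv ℝ h (τ, x₀)).comp (ContinuousLinearMap.inr ℝ ℝ E)
    have hdiff : ∀ᶠ p in 𝓝 (0, x₀), DifferentiableAt ℝ h p :=
      (hh.eventually (by simp)).mono fun p hp ↦ hp.differentiableAt one_ne_zero
    have hdiff' : ∀ᶠ τ in 𝓝 (0 : ℝ), DifferentiableAt ℝ h (τ, x₀) :=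
      (Continuous.prodMk_left x₀).tendsto (0 : ℝ) |>.eventually hdiff
    have hfd : (fun τ ↦ fderiv ℝ (fun x ↦ Φ (τ, x) 1) x₀) =ᶠ[𝓝 0]
        fun τ ↦ ContinuousLinearMap.id ℝ E + τ • c τ := by
      filter_upwards [hdiff'] with τ hτ
      exact ((hasFDerivAt_id x₀).add
        ((HasFDerivAt.comp (g := h) x₀ hτ.hasFDerivAt (hinr τ)).const_smul τ)).fderiv
    have hc : ContinuousAt c 0 := by
      have h1 : ContinuousAt (fderiv ℝ h) (0, x₀) :=
        (hh.fderiv_right (m := 0) (by simp)).continuousAt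
      exact (ContinuousAt.comp (f := fun τ : ℝ ↦ (τ, x₀)) (x := (0 : ℝ)) h1
        (Continuous.prodMk_left x₀).continuousAt).clm_comp continuousAt_const
    -- For `τ = 0` the solution is the constant curve `x`, so `h (0, x)` is the integral of the
    -- constant `X x` over `[0, 1]`.
    have hc0 : c 0 = fderiv ℝ X x₀ := by
      have h2 : (fun x : E ↦ h (0, x)) =ᶠ[𝓝 x₀] X := by
        filter_upwards [(Continuous.prodMk_right (0 : ℝ)).tendsto x₀ |>.eventually hSeq, hYX]
          with x hx hxY
        simp only [zero_smul, add_zero] at hx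
        have : h (0, x) = ∫ r in (0 : ℝ)..1, Y x := by
          simp only [h, hx]
          rfl
        rw [this, ← hxY]
        simp
      rw [← h2.fderiv_eq]
      exact (HasFDerivAt.comp (g := h) x₀ hdiff'.self_of_nhds.hasFDerivAt (hinr 0)).fderiv.symm
    rw [← hc0]
    exact ((hasDerivAt_smul_of_continuousAt hc).const_add _).congr_of_eventuallyEq hfd

end LocalFlow

end GradFlow

namespace GradFlow

/-! ### Vector fields in chart coordinates -/

section ChartField

open Set Filter Topology

variable {E : Type*} [NormedAddCommGroup E] [NormedSpace ℝ E]
  {M : Type*} [TopologicalSpace M] [ChartedSpace E M]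

theorem extChartAt_symm_mem_chart_source {x₀ : M} {y : E}
    (hy : y ∈ (extChartAt 𝓘(ℝ, E) x₀).target) :
    (extChartAt 𝓘(ℝ, E) x₀).symm y ∈ (chartAt E x₀).source := by
  simpa using (extChartAt 𝓘(ℝ, E) x₀).map_target hy

variable [IsManifold 𝓘(ℝ, E) ∞ M]

theorem hasMFDerivAt_extChartAt_trivializationAt {x₀ p : M} (hp : p ∈ (chartAt E x₀).source) :
    HasMFDerivAt 𝓘(ℝ, E) 𝓘(ℝ, E) (extChartAt 𝓘(ℝ, E) x₀) p
      ((trivializationAt E (TangentSpace 𝓘(ℝ, E)) x₀).continuousLinearMapAt ℝ p) := by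
  rw [TangentBundle.continuousLinearMapAt_trivializationAt hp]
  exact (mdifferentiableAt_extChartAt hp).hasMFDerivAt

theorem hasMFDerivAt_extChartAt_symm {x₀ : M} {y : E}
    (hy : y ∈ (extChartAt 𝓘(ℝ, E) x₀).target) :
    HasMFDerivAt 𝓘(ℝ, E) 𝓘(ℝ, E) (extChartAt 𝓘(ℝ, E) x₀).symm y
      ((trivializationAt E (TangentSpace 𝓘(ℝ, E)) x₀).symmL ℝ
        ((extChartAt 𝓘(ℝ, E) x₀).symm y)) := by
  rw [TangentBundle.symmL_trivializationAt (extChartAt_symm_mem_chart_source hy),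
    (extChartAt 𝓘(ℝ, E) x₀).right_inv hy]
  have := mdifferentiableWithinAt_extChartAt_symm (I := 𝓘(ℝ, E)) hy
  rw [modelWithCornersSelf_coe, range_id] at this ⊢
  rw [mfderivWithin_univ]
  exact (mdifferentiableWithinAt_univ.1 this).hasMFDerivAt

/-- A vector field in the coordinates of the chart at `x₀`. -/
noncomputable def chartField (X : (x : M) → TangentSpace 𝓘(ℝ, E) x) (x₀ : M) (y : E) : E :=
  (trivializationAt E (TangentSpace 𝓘(ℝ, E)) x₀).continuousLinearMapAt ℝ
    ((extChartAt 𝓘(ℝ, E) x₀).symm y) (X ((extChartAt 𝓘(ℝ, E) x₀).symm y))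

theorem symmL_chartField (X : (x : M) → TangentSpace 𝓘(ℝ, E) x) {x₀ : M} {y : E}
    (hy : y ∈ (extChartAt 𝓘(ℝ, E) x₀).target) :
    (trivializationAt E (TangentSpace 𝓘(ℝ, E)) x₀).symmL ℝ ((extChartAt 𝓘(ℝ, E) x₀).symm y)
      (chartField X x₀ y) = X ((extChartAt 𝓘(ℝ, E) x₀).symm y) :=
  Trivialization.symmL_continuousLinearMapAt _ (extChartAt_symm_mem_chart_source hy) _

theorem chartField_smul (c : ℝ) (X : (x : M) → TangentSpace 𝓘(ℝ, E) x) (x₀ : M) (y : E) :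
    chartField (c • X) x₀ y = c • chartField X x₀ y := by
  simp only [chartField, Pi.smul_apply, map_smul]

/-- A section of the tangent bundle is `C^n` at a point iff its coordinates are. -/
theorem contMDiffAt_section_iff_chartField (X : (x : M) → TangentSpace 𝓘(ℝ, E) x) (x₀ : M)
    (n : WithTop ℕ∞) (hn : n ≤ ∞) :
    ContMDiffAt 𝓘(ℝ, E) (𝓘(ℝ, E).prod 𝓘(ℝ, E)) n (fun x ↦ (⟨x, X x⟩ : TangentBundle 𝓘(ℝ, E) M)) x₀
      ↔ ContDiffAt ℝ n (chartField X x₀) (extChartAt 𝓘(ℝ, E) x₀ x₀) := by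
  have : IsManifold 𝓘(ℝ, E) n M := .of_le hn
  have hsrc : (chartAt E x₀).source ∈ 𝓝 x₀ := chart_source_mem_nhds E x₀
  rw [Bundle.contMDiffAt_section]
  have h1 : (fun x ↦ (trivializationAt E (TangentSpace 𝓘(ℝ, E)) x₀ ⟨x, X x⟩).2) =ᶠ[𝓝 x₀]
      fun x ↦ (trivializationAt E (TangentSpace 𝓘(ℝ, E)) x₀).continuousLinearMapAt ℝ x (X x) := by
    filter_upwards [hsrc] with x hx
    rw [Trivialization.continuousLinearMapAt_apply, Trivialization.coe_linearMapAt_of_mem _ hx]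
  rw [h1.contMDiffAt_iff, contMDiffAt_iff_source (x := x₀), modelWithCornersSelf_coe, range_id,
    contMDiffWithinAt_univ, contMDiffAt_iff_contDiffAt]
  rfl

end ChartField

/-! ### The global flow: group law, regularity and derivative at time zero -/

section Flow

open Set Filter Topology

variable {E : Type*} [NormedAddCommGroup E] [NormedSpace ℝ E]
  {M : Type*} [TopologicalSpace M] [ChartedSpace E M]
  {X : (x : M) → TangentSpace 𝓘(ℝ, E) x}

theorem flow_zero (hX : IsCompleteField X) (x : M) : flow X hX 0 x = x :=
  (hX x).choose_spec.1

theorem isMIntegralCurve_flow (hX : IsCompleteField X) (x : M) :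
    IsMIntegralCurve (fun t ↦ flow X hX t x) X :=
  (hX x).choose_spec.2

variable [T2Space M] [IsManifold 𝓘(ℝ, E) ∞ M]

/-- In `s`, both sides are integral curves starting at `flow X hX t x`, so uniqueness applies. -/
theorem flow_add (hXs : ContMDiff 𝓘(ℝ, E) (𝓘(ℝ, E).prod 𝓘(ℝ, E)) 1
    (fun x ↦ (⟨x, X x⟩ : TangentBundle 𝓘(ℝ, E) M))) (hX : IsCompleteField X) (s t : ℝ) (x : M) :
    flow X hX (s + t) x = flow X hX s (flow X hX t x) := by
  have : IsManifold 𝓘(ℝ, E) 1 M := .of_le (n := ∞) (by simp)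
  have h1 := (isMIntegralCurve_flow hX x).comp_add t
  have h2 := isMIntegralCurve_flow hX (flow X hX t x)
  exact congrFun (isMIntegralCurve_Ioo_eq_of_contMDiff_boundaryless (t₀ := 0) hXs h1 h2
    (by simp [flow_zero])) s

variable [FiniteDimensional ℝ E]

/-- Near `x₀` and for small times, the flow is the local flow in the chart at `x₀`. -/
theorem exists_flow_eq_chart (hXs : ContMDiff 𝓘(ℝ, E) (𝓘(ℝ, E).prod 𝓘(ℝ, E)) 1
    (fun x ↦ (⟨x, X x⟩ : TangentBundle 𝓘(ℝ, E) M))) (hX : IsCompleteField X) (x₀ : M) :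
    ∃ φ : ℝ × E → E, ContDiffAt ℝ 1 φ (0, extChartAt 𝓘(ℝ, E) x₀ x₀) ∧
      (∀ᶠ p in 𝓝 ((0 : ℝ), extChartAt 𝓘(ℝ, E) x₀ x₀), φ p ∈ (extChartAt 𝓘(ℝ, E) x₀).target ∧
        flow X hX p.1 ((extChartAt 𝓘(ℝ, E) x₀).symm p.2)
          = (extChartAt 𝓘(ℝ, E) x₀).symm (φ p)) ∧
      HasDerivAt (fun τ ↦ fderiv ℝ (fun y ↦ φ (τ, y)) (extChartAt 𝓘(ℝ, E) x₀ x₀))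
        (fderiv ℝ (chartField X x₀) (extChartAt 𝓘(ℝ, E) x₀ x₀)) 0 := by
  have : IsManifold 𝓘(ℝ, E) 1 M := .of_le (n := ∞) (by simp)
  set ψ := extChartAt 𝓘(ℝ, E) x₀ with hψ
  obtain ⟨Φ, hΦ1, hΦ2, hΦ3⟩ := exists_local_flow
    ((contMDiffAt_section_iff_chartField X x₀ 1 (by simp)).1 (hXs x₀))
  refine ⟨fun p ↦ Φ p 1, hΦ1, ?_, hΦ3⟩
  filter_upwards [hΦ2 ψ.target (extChartAt_target_mem_nhds x₀)] with p hp
  refine ⟨(hp.2 1 (by norm_num)).1, ?_⟩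
  -- With time rescaled by `p.1`, the global and the local flow line are both integral curves of
  -- `p.1 • X` on `(-2, 2)` with the same initial point. They are compared at `s = 1`, which lies
  -- inside this interval.
  have hflow := ((isMIntegralCurve_flow hX (ψ.symm p.2)).comp_mul p.1).isMIntegralCurveOn
    (Ioo (-2) 2)
  have hloc : IsMIntegralCurveOn (fun s ↦ ψ.symm (Φ p s)) (p.1 • X) (Ioo (-2) 2) := by
    intro s hs
    obtain ⟨hsW, hsd⟩ := hp.2 s hs
    refine (((hasMFDerivAt_extChartAt_symm hsW).comp s
      hsd.hasFDerivAt.hasMFDerivAt).congr_mfderiv ?_).hasMFDerivWithinAt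
    refine ContinuousLinearMap.ext_ring ?_
    change (trivializationAt E (TangentSpace 𝓘(ℝ, E)) x₀).symmL ℝ (ψ.symm (Φ p s))
      ((1 : ℝ) • p.1 • chartField X x₀ (Φ p s)) = (1 : ℝ) • p.1 • X (ψ.symm (Φ p s))
    rw [one_smul, one_smul, map_smul, symmL_chartField X hsW]
  have hsmooth : ContMDiff 𝓘(ℝ, E) (𝓘(ℝ, E).prod 𝓘(ℝ, E)) 1
      (fun x ↦ (⟨x, (p.1 • X) x⟩ : TangentBundle 𝓘(ℝ, E) M)) := by
    intro x
    rw [contMDiffAt_section_iff_chartField _ _ _ (by simp)]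
    rw [show chartField (p.1 • X) x = fun y ↦ p.1 • chartField X x y from
      funext fun y ↦ chartField_smul _ _ _ _]
    exact ((contMDiffAt_section_iff_chartField X x 1 (by simp)).1 (hXs x)).const_smul p.1
  have := isMIntegralCurveOn_Ioo_eqOn_of_contMDiff_boundaryless (t₀ := 0) (by norm_num) hsmooth
    hflow hloc (by simp [flow_zero, hp.1])
  simpa using this (show (1 : ℝ) ∈ Ioo (-2) 2 by norm_num)

/-- For small times and near a given point, the flow maps are `C¹`. -/
theorem eventually_contMDiffAt_flow (hXs : ContMDiff 𝓘(ℝ, E) (𝓘(ℝ, E).prod 𝓘(ℝ, E)) 1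
    (fun x ↦ (⟨x, X x⟩ : TangentBundle 𝓘(ℝ, E) M))) (hX : IsCompleteField X) (x₀ : M) :
    ∀ᶠ z in 𝓝 ((0 : ℝ), x₀), ContMDiffAt 𝓘(ℝ, E) 𝓘(ℝ, E) 1 (flow X hX z.1) z.2 := by
  have : IsManifold 𝓘(ℝ, E) 1 M := .of_le (n := ∞) (by simp)
  set ψ := extChartAt 𝓘(ℝ, E) x₀ with hψ
  obtain ⟨φ, hφ, hφe, -⟩ := exists_flow_eq_chart hXs hX x₀
  have hψc : ContinuousAt (fun z : ℝ × M ↦ (z.1, ψ z.2)) (0, x₀) :=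
    continuousAt_fst.prodMk ((continuousAt_extChartAt x₀).comp (f := Prod.snd) continuousAt_snd)
  have hsrc : ∀ᶠ z : ℝ × M in 𝓝 (0, x₀), z.2 ∈ (chartAt E x₀).source :=
    continuousAt_snd.eventually_mem (chart_source_mem_nhds E x₀)
  filter_upwards [hψc.eventually (hφ.eventually (by simp)),
    hψc.eventually (eventually_eventually_nhds.2 hφe), hsrc] with z hz1 hz2 hz3
  have hψz : ContMDiffAt 𝓘(ℝ, E) 𝓘(ℝ, E) 1 ψ z.2 := contMDiffAt_extChartAt' hz3
  have hφz : ContDiffAt ℝ 1 (fun y ↦ φ (z.1, y)) (ψ z.2) :=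
    ContDiffAt.comp (g := φ) (ψ z.2) hz1 (contDiff_prodMk_right z.1).contDiffAt
  have hsymm : ContMDiffAt 𝓘(ℝ, E) 𝓘(ℝ, E) 1 ψ.symm (φ (z.1, ψ z.2)) :=
    (contMDiffOn_extChartAt_symm x₀).contMDiffAt
      ((isOpen_extChartAt_target x₀).mem_nhds hz2.self_of_nhds.1)
  have hcomp : ContMDiffAt 𝓘(ℝ, E) 𝓘(ℝ, E) 1 (fun x ↦ ψ.symm (φ (z.1, ψ x))) z.2 :=
    ContMDiffAt.comp (g := ψ.symm) z.2 hsymm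
      (ContMDiffAt.comp (g := fun y ↦ φ (z.1, y)) z.2 hφz.contMDiffAt hψz)
  refine hcomp.congr_of_eventuallyEq ?_
  have hcont : ContinuousAt (fun x ↦ (z.1, ψ x)) z.2 := continuousAt_const.prodMk hψz.continuousAt
  filter_upwards [hcont.eventually hz2, (chartAt E x₀).open_source.mem_nhds hz3] with x hx hxs
  rw [← hx.2, ψ.left_inv (by simpa [hψ] using hxs)]

/-- The time-`t` maps of a complete `C¹` vector field are `C¹`. -/
theorem contMDiff_flow (hXs : ContMDiff 𝓘(ℝ, E) (𝓘(ℝ, E).prod 𝓘(ℝ, E)) 1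
    (fun x ↦ (⟨x, X x⟩ : TangentBundle 𝓘(ℝ, E) M))) (hX : IsCompleteField X) (t : ℝ) :
    ContMDiff 𝓘(ℝ, E) 𝓘(ℝ, E) 1 (flow X hX t) := by
  intro x
  let T : ℝ → Prop := fun s ↦ ContMDiffAt 𝓘(ℝ, E) 𝓘(ℝ, E) 1 (flow X hX s) x
  -- Connectedness of `ℝ` spreads regularity from time `0` to all times. For `q` near `(s, s)` the
  -- map at time `q.2` is the one at time `q.1` followed by a flow map of small time, which is `C¹`
  -- near `flow X hX s x`. Taking `q = (s, y)` and `q = (y, s)` gives both implications.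
  have hT : IsLocallyConstant T := by
    rw [IsLocallyConstant.iff_eventually_eq]
    intro s
    have hc : ContinuousAt (fun q : ℝ × ℝ ↦ (q.2 - q.1, flow X hX q.1 x)) (s, s) := by
      have := (isMIntegralCurve_flow hX x).continuous
      fun_prop
    have key : ∀ᶠ q in 𝓝 (s, s), T q.1 → T q.2 := by
      have h := eventually_contMDiffAt_flow hXs hX (flow X hX s x)
      rw [← sub_self s] at h
      filter_upwards [hc.eventually h] with q hq hq1
      have := ContMDiffAt.comp x hq hq1
      rwa [show flow X hX (q.2 - q.1) ∘ flow X hX q.1 = flow X hX q.2 from funext fun z ↦ by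
        rw [Function.comp_apply, ← flow_add hXs, sub_add_cancel]] at this
    filter_upwards [(Continuous.prodMk_right s).continuousAt.eventually key,
      (Continuous.prodMk_left s).continuousAt.eventually key] with y h1 h2
    exact propext ⟨h2, h1⟩
  have h0 : T 0 := contMDiffAt_id.congr_of_eventuallyEq (.of_forall (flow_zero hX))
  exact (hT.apply_eq_of_preconnectedSpace t 0).mpr h0

/-- The derivative of the flow near time `0` in the chart at `x₀`: its derivative with respect to
time is the derivative of the vector field. -/
theorem exists_hasMFDerivAt_flow (hXs : ContMDiff 𝓘(ℝ, E) (𝓘(ℝ, E).prod 𝓘(ℝ, E)) 1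
    (fun x ↦ (⟨x, X x⟩ : TangentBundle 𝓘(ℝ, E) M))) (hX : IsCompleteField X) (x₀ : M) :
    ∃ A : ℝ → E →L[ℝ] E, A 0 = ContinuousLinearMap.id ℝ E ∧
      HasDerivAt A (fderiv ℝ (chartField X x₀) (extChartAt 𝓘(ℝ, E) x₀ x₀)) 0 ∧
      ∀ᶠ τ in 𝓝 (0 : ℝ), HasMFDerivAt 𝓘(ℝ, E) 𝓘(ℝ, E) (flow X hX τ) x₀
        ((trivializationAt E (TangentSpace 𝓘(ℝ, E)) x₀).symmL ℝ (flow X hX τ x₀) ∘L A τ ∘L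
          (trivializationAt E (TangentSpace 𝓘(ℝ, E)) x₀).continuousLinearMapAt ℝ x₀) := by
  set ψ := extChartAt 𝓘(ℝ, E) x₀ with hψ
  obtain ⟨φ, hφ, hφe, hφd⟩ := exists_flow_eq_chart hXs hX x₀
  refine ⟨_, ?_, hφd, ?_⟩
  · have h0 : (fun y ↦ φ (0, y)) =ᶠ[𝓝 (ψ x₀)] id := by
      filter_upwards [(Continuous.prodMk_right (0 : ℝ)).continuousAt.eventually hφe,
        extChartAt_target_mem_nhds x₀] with y hy hyt
      rw [flow_zero] at hy
      exact ψ.symm.injOn hy.1 hyt hy.2.symm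
    rw [h0.fderiv_eq, fderiv_id]
  · have hc : ContinuousAt (fun τ : ℝ ↦ (τ, ψ x₀)) 0 := (Continuous.prodMk_left _).continuousAt
    filter_upwards [hc.eventually (hφ.eventually (by simp)),
      hc.eventually (eventually_eventually_nhds.2 hφe)] with τ hτ1 hτ2
    have hφτ : DifferentiableAt ℝ (fun y ↦ φ (τ, y)) (ψ x₀) :=
      (ContDiffAt.comp (g := φ) (ψ x₀) hτ1
        (contDiff_prodMk_right τ).contDiffAt).differentiableAt one_ne_zero
    have h := (hasMFDerivAt_extChartAt_symm hτ2.self_of_nhds.1).comp x₀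
      (hφτ.hasFDerivAt.hasMFDerivAt.comp x₀
        (hasMFDerivAt_extChartAt_trivializationAt (mem_chart_source E x₀)))
    have hval : flow X hX τ x₀ = ψ.symm (φ (τ, ψ x₀)) := by
      have := hτ2.self_of_nhds.2
      rwa [ψ.left_inv (mem_extChartAt_source x₀)] at this
    have heq : flow X hX τ =ᶠ[𝓝 x₀] ψ.symm ∘ (fun y ↦ φ (τ, y)) ∘ ψ := by
      have hcont : ContinuousAt (fun x ↦ (τ, ψ x)) x₀ :=
        continuousAt_const.prodMk (continuousAt_extChartAt x₀)
      filter_upwards [hcont.eventually hτ2, extChartAt_source_mem_nhds (I := 𝓘(ℝ, E)) x₀]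
        with x hx hxs
      have := hx.2
      rwa [ψ.left_inv hxs] at this
    rw [← hval] at h
    exact h.congr_of_eventuallyEq heq

end Flow

end GradFlow

namespace GradFlow

section

open Set Filter Topology

variable {E F D : Type*} [NormedAddCommGroup E] [NormedSpace ℝ E]
  [NormedAddCommGroup F] [NormedSpace ℝ F] [NormedAddCommGroup D] [NormedSpace ℝ D]

/-- A family of linear maps on a finite-dimensional space is `C^n` if it is so pointwise. -/
theorem contDiffAt_clm_of_apply [FiniteDimensional ℝ E] {n : WithTop ℕ∞} {G : D → E →L[ℝ] F}
    {y₀ : D} (h : ∀ u, ContDiffAt ℝ n (fun y ↦ G y u) y₀) : ContDiffAt ℝ n G y₀ := by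
  have hd : Module.finrank ℝ E = Module.finrank ℝ (Fin (Module.finrank ℝ E) → ℝ) :=
    (Module.finrank_fin_fun ℝ).symm
  let e₁ := ContinuousLinearEquiv.ofFinrankEq hd
  let e₂ := (e₁.arrowCongr (1 : F ≃L[ℝ] F)).trans
    (ContinuousLinearEquiv.piRing (Fin (Module.finrank ℝ E)))
  rw [← Function.id_comp G, ← e₂.symm_comp_self]
  exact e₂.symm.contDiff.contDiffAt.comp y₀ (contDiffAt_pi.mpr fun i ↦ h _)

variable {M : Type*} [TopologicalSpace M] [ChartedSpace E M] [IsManifold 𝓘(ℝ, E) ∞ M]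

theorem contDiffAt_comp_extChartAt_symm {f : M → ℝ} {n : WithTop ℕ∞} (hn : n ≤ ∞)
    (hf : ContMDiff 𝓘(ℝ, E) 𝓘(ℝ, ℝ) n f) (x₀ : M) :
    ContDiffAt ℝ n (f ∘ (extChartAt 𝓘(ℝ, E) x₀).symm) (extChartAt 𝓘(ℝ, E) x₀ x₀) := by
  have : IsManifold 𝓘(ℝ, E) n M := .of_le hn
  exact ((hf _).comp _ ((contMDiffOn_extChartAt_symm x₀).contMDiffAt
    (extChartAt_target_mem_nhds x₀))).contDiffAt

end

/-! ### The metric and the gradient field in a chart -/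

section ChartMetric

open Set Filter Topology

variable {E : Type*} [NormedAddCommGroup E] [NormedSpace ℝ E]
  {M : Type*} [TopologicalSpace M] [ChartedSpace E M] [IsManifold 𝓘(ℝ, E) ∞ M]
  [RiemannianBundle (fun x : M ↦ TangentSpace 𝓘(ℝ, E) x)]

theorem chartMetric_apply (x₀ : M) (y u v : E) :
    chartMetric x₀ y u v =
      ⟪(trivializationAt E (TangentSpace 𝓘(ℝ, E)) x₀).symmL ℝ ((extChartAt 𝓘(ℝ, E) x₀).symm y) u,
        (trivializationAt E (TangentSpace 𝓘(ℝ, E)) x₀).symmL ℝ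
          ((extChartAt 𝓘(ℝ, E) x₀).symm y) v⟫ :=
  rfl

theorem chartMetric_symm (x₀ : M) (y u v : E) : chartMetric x₀ y u v = chartMetric x₀ y v u := by
  rw [chartMetric_apply, chartMetric_apply, real_inner_comm]

theorem ker_chartMetric {x₀ : M} {y : E} (hy : y ∈ (extChartAt 𝓘(ℝ, E) x₀).target) {u : E}
    (hu : chartMetric x₀ y u = 0) : u = 0 := by
  have h : chartMetric x₀ y u u = 0 := by rw [hu]; rfl
  rw [chartMetric_apply, inner_self_eq_zero] at h
  have := Trivialization.continuousLinearMapAt_symmL (R := ℝ)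
    (trivializationAt E (TangentSpace 𝓘(ℝ, E)) x₀) (extChartAt_symm_mem_chart_source hy) u
  rw [← this, h, map_zero]

variable [FiniteDimensional ℝ E]

/-- Lowering the index removes the inverse metric from the coordinate formula of the gradient. The
relation is solved for the field in `contDiffAt_chartField_grad` and differentiated in
`lieDeriv_chartMetric_grad`. -/
theorem chartMetric_chartField_grad {f : M → ℝ} (hf : MDifferentiable 𝓘(ℝ, E) 𝓘(ℝ, ℝ) f) {x₀ : M}
    {y : E} (hy : y ∈ (extChartAt 𝓘(ℝ, E) x₀).target) :
    chartMetric x₀ y (chartField (grad f) x₀ y)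
      = fderiv ℝ (f ∘ (extChartAt 𝓘(ℝ, E) x₀).symm) y := by
  ext w
  rw [chartMetric_apply, symmL_chartField _ hy, grad, inner_riesz]
  have h : HasFDerivAt (f ∘ (extChartAt 𝓘(ℝ, E) x₀).symm)
      (show E →L[ℝ] ℝ from mfderiv 𝓘(ℝ, E) 𝓘(ℝ, ℝ) f ((extChartAt 𝓘(ℝ, E) x₀).symm y) ∘L
        (trivializationAt E (TangentSpace 𝓘(ℝ, E)) x₀).symmL ℝ
          ((extChartAt 𝓘(ℝ, E) x₀).symm y)) y :=
    ((hf ((extChartAt 𝓘(ℝ, E) x₀).symm y)).hasMFDerivAt.comp y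
      (hasMFDerivAt_extChartAt_symm hy)).hasFDerivAt
  rw [h.fderiv]
  rfl

variable [IsContMDiffRiemannianBundle 𝓘(ℝ, E) ∞ E (fun x : M ↦ TangentSpace 𝓘(ℝ, E) x)]

/-- The frame fields of a chart have constant coordinates in it, hence are smooth sections, and the
bundle metric of smooth sections is smooth. -/
theorem contDiffAt_chartMetric (x₀ : M) :
    ContDiffAt ℝ ∞ (chartMetric x₀) (extChartAt 𝓘(ℝ, E) x₀ x₀) := by
  have hframe (u : E) : ContMDiffAt 𝓘(ℝ, E) (𝓘(ℝ, E).prod 𝓘(ℝ, E)) ∞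
      (fun x ↦ (⟨x, (trivializationAt E (TangentSpace 𝓘(ℝ, E)) x₀).symmL ℝ x u⟩ :
        TangentBundle 𝓘(ℝ, E) M)) x₀ := by
    rw [contMDiffAt_section_iff_chartField _ _ _ le_rfl]
    refine (contDiffAt_const (c := u)).congr_of_eventuallyEq ?_
    filter_upwards [extChartAt_target_mem_nhds (I := 𝓘(ℝ, E)) x₀] with y hy
    exact Trivialization.continuousLinearMapAt_symmL _ (extChartAt_symm_mem_chart_source hy) u
  refine contDiffAt_clm_of_apply fun u ↦ contDiffAt_clm_of_apply fun v ↦ ?_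
  have h := ContMDiffAt.inner_bundle (E := fun x : M ↦ TangentSpace 𝓘(ℝ, E) x) (b := fun x ↦ x)
    (v := fun x ↦ (trivializationAt E (TangentSpace 𝓘(ℝ, E)) x₀).symmL ℝ x u)
    (w := fun x ↦ (trivializationAt E (TangentSpace 𝓘(ℝ, E)) x₀).symmL ℝ x v)
    (hframe u) (hframe v)
  have hs : ContMDiffAt 𝓘(ℝ, E) 𝓘(ℝ, E) ∞ (extChartAt 𝓘(ℝ, E) x₀).symm
      (extChartAt 𝓘(ℝ, E) x₀ x₀) :=
    (contMDiffOn_extChartAt_symm x₀).contMDiffAt (extChartAt_target_mem_nhds x₀)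
  exact (h.comp_of_eq hs (extChartAt_to_inv x₀)).contDiffAt

/-- In coordinates the gradient is the inverse metric applied to `df`. The metric is invertible by
definiteness and a dimension count, inversion is smooth, and `df` is `C¹`. -/
theorem contDiffAt_chartField_grad {f : M → ℝ} (hf : ContMDiff 𝓘(ℝ, E) 𝓘(ℝ, ℝ) 2 f) (x₀ : M) :
    ContDiffAt ℝ 1 (chartField (grad f) x₀) (extChartAt 𝓘(ℝ, E) x₀ x₀) := by
  have := FiniteDimensional.complete ℝ E
  have hequiv {y : E} (hy : y ∈ (extChartAt 𝓘(ℝ, E) x₀).target) :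
      ∃ e : E ≃L[ℝ] (E →L[ℝ] ℝ), (e : E →L[ℝ] E →L[ℝ] ℝ) = chartMetric x₀ y := by
    let e : E ≃ₗ[ℝ] (E →L[ℝ] ℝ) := LinearEquiv.ofInjectiveOfFinrankEq (chartMetric x₀ y).toLinearMap
      (LinearMap.ker_eq_bot.1 (LinearMap.ker_eq_bot'.2 fun u hu ↦ ker_chartMetric hy hu)) ?_
    · exact ⟨e.toContinuousLinearEquiv, by ext; rfl⟩
    · rw [← LinearMap.toContinuousLinearMap.finrank_eq, Subspace.dual_finrank_eq]
  have hy₀ := mem_extChartAt_target (I := 𝓘(ℝ, E)) x₀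
  obtain ⟨e₀, he₀⟩ := hequiv hy₀
  have hinv : ContDiffAt ℝ 1 (fun y ↦ ContinuousLinearMap.inverse (chartMetric x₀ y))
      (extChartAt 𝓘(ℝ, E) x₀ x₀) :=
    ContDiffAt.comp _ (he₀ ▸ contDiffAt_map_inverse e₀)
      ((contDiffAt_chartMetric x₀).of_le (by simp))
  have hdf := (contDiffAt_comp_extChartAt_symm (n := 2) ENat.LEInfty.out hf x₀).fderiv_right (m := 1) (by norm_num)
  refine (hinv.clm_apply hdf).congr_of_eventuallyEq ?_
  filter_upwards [extChartAt_target_mem_nhds (I := 𝓘(ℝ, E)) x₀] with y hy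
  obtain ⟨e, he⟩ := hequiv hy
  rw [← chartMetric_chartField_grad (hf.mdifferentiable two_ne_zero) hy, ← he,
    ContinuousLinearMap.inverse_equiv]
  exact (e.symm_apply_apply _).symm

theorem contMDiff_grad {f : M → ℝ} (hf : ContMDiff 𝓘(ℝ, E) 𝓘(ℝ, ℝ) 2 f) :
    ContMDiff 𝓘(ℝ, E) (𝓘(ℝ, E).prod 𝓘(ℝ, E)) 1
      (fun x ↦ (⟨x, grad f x⟩ : TangentBundle 𝓘(ℝ, E) M)) := fun x₀ ↦
  (contMDiffAt_section_iff_chartField _ x₀ 1 (by simp)).2 (contDiffAt_chartField_grad hf x₀)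

end ChartMetric

end GradFlow

namespace GradFlow

set_option synthInstance.maxHeartbeats 200000 in
theorem hasDerivAt_bilin_apply {E F : Type*} [NormedAddCommGroup E] [NormedSpace ℝ E]
    [NormedAddCommGroup F] [NormedSpace ℝ F] {G : E → F →L[ℝ] F →L[ℝ] ℝ}
    {G' : E →L[ℝ] F →L[ℝ] F →L[ℝ] ℝ} {c : ℝ → E} {u v : ℝ → F} {c' : E} {u' v' : F} {t : ℝ}
    (hG : HasFDerivAt G G' (c t)) (hc : HasDerivAt c c' t) (hu : HasDerivAt u u' t)
    (hv : HasDerivAt v v' t) :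
    HasDerivAt (fun τ ↦ G (c τ) (u τ) (v τ))
      (G' c' (u t) (v t) + G (c t) u' (v t) + G (c t) (u t) v') t := by
  have hGc : HasFDerivAt (fun τ ↦ G (c τ)) _ t := HasFDerivAt.comp (g := G) t hG hc.hasFDerivAt
  have h := ((hGc.clm_apply hu.hasFDerivAt).clm_apply hv.hasFDerivAt).hasDerivAt
  refine h.congr_deriv ?_
  change G (c t) (u t) ((1 : ℝ) • v')
    + (G (c t) ((1 : ℝ) • u') + G' ((1 : ℝ) • c') (u t)) (v t) = _
  rw [one_smul, one_smul, one_smul, add_apply]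
  ring

/-! ### The Hessian as first variation of the metric -/

section Hessian

open Set Filter Topology

variable {E : Type*} [NormedAddCommGroup E] [NormedSpace ℝ E]
  {M : Type*} [TopologicalSpace M] [ChartedSpace E M] [IsManifold 𝓘(ℝ, E) ∞ M]

/-- The base point is a variable `p`, so that the equality can be substituted despite the dependence
of the fibre on it. -/
theorem continuousLinearMapAt_eq_chartCoord (X : (x : M) → TangentSpace 𝓘(ℝ, E) x) {x₀ p : M}
    (hp : p = x₀) : (trivializationAt E (TangentSpace 𝓘(ℝ, E)) x₀).continuousLinearMapAt ℝ p (X p)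
      = chartCoord x₀ (X x₀) := by
  subst hp
  rfl

theorem chartField_extChartAt_self (X : (x : M) → TangentSpace 𝓘(ℝ, E) x) (x₀ : M) :
    chartField X x₀ (extChartAt 𝓘(ℝ, E) x₀ x₀) = chartCoord x₀ (X x₀) :=
  continuousLinearMapAt_eq_chartCoord X (extChartAt_to_inv x₀)

variable [RiemannianBundle (fun x : M ↦ TangentSpace 𝓘(ℝ, E) x)]

theorem chartMetric_extChartAt {x₀ p : M} (hp : p ∈ (extChartAt 𝓘(ℝ, E) x₀).source) (u v : E) :
    chartMetric x₀ (extChartAt 𝓘(ℝ, E) x₀ p) u v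
      = ⟪(trivializationAt E (TangentSpace 𝓘(ℝ, E)) x₀).symmL ℝ p u,
        (trivializationAt E (TangentSpace 𝓘(ℝ, E)) x₀).symmL ℝ p v⟫ := by
  rw [chartMetric_apply, (extChartAt 𝓘(ℝ, E) x₀).left_inv hp]

variable [FiniteDimensional ℝ E]

/-- Pairing with the gradient undoes the raising of the index in `christoffel`, so only symbols of
the first kind remain. -/
theorem mvfderiv_christoffel (f : M → ℝ) (x₀ : M) (u v : E) :
    mvfderiv 𝓘(ℝ, E) f x₀ (christoffel x₀ u v)
      = christoffelLower (chartMetric x₀) (extChartAt 𝓘(ℝ, E) x₀ x₀) u v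
        (chartField (grad f) x₀ (extChartAt 𝓘(ℝ, E) x₀ x₀)) := by
  rw [chartField_extChartAt_self, ← inner_riesz, real_inner_comm, christoffel, inner_riesz]
  rfl

variable [IsContMDiffRiemannianBundle 𝓘(ℝ, E) ∞ E (fun x : M ↦ TangentSpace 𝓘(ℝ, E) x)]

theorem fderiv_chartMetric_symm (x₀ : M) (a u v : E) :
    fderiv ℝ (chartMetric x₀) (extChartAt 𝓘(ℝ, E) x₀ x₀) a u v
      = fderiv ℝ (chartMetric x₀) (extChartAt 𝓘(ℝ, E) x₀ x₀) a v u := by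
  have hG := ((contDiffAt_chartMetric (E := E) x₀).differentiableAt (by simp)).hasFDerivAt
  have h (u v : E) := ((hG.clm_apply (hasFDerivAt_const u _)).clm_apply (hasFDerivAt_const v _))
  have huv := (h u v).unique ((h v u).congr_of_eventuallyEq
    (.of_forall fun y ↦ chartMetric_symm x₀ y u v))
  simpa using DFunLike.congr_fun huv a

/-- The Lie derivative of the metric along the gradient field is twice the Hessian. -/
theorem lieDeriv_chartMetric_grad {f : M → ℝ} (hf : ContMDiff 𝓘(ℝ, E) 𝓘(ℝ, ℝ) 2 f) (x₀ : M)
    (U V : TangentSpace 𝓘(ℝ, E) x₀) :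
    fderiv ℝ (chartMetric x₀) (extChartAt 𝓘(ℝ, E) x₀ x₀)
        (chartField (grad f) x₀ (extChartAt 𝓘(ℝ, E) x₀ x₀)) (chartCoord x₀ U) (chartCoord x₀ V)
      + chartMetric x₀ (extChartAt 𝓘(ℝ, E) x₀ x₀)
        (fderiv ℝ (chartField (grad f) x₀) (extChartAt 𝓘(ℝ, E) x₀ x₀) (chartCoord x₀ U))
        (chartCoord x₀ V)
      + chartMetric x₀ (extChartAt 𝓘(ℝ, E) x₀ x₀) (chartCoord x₀ U)
        (fderiv ℝ (chartField (grad f) x₀) (extChartAt 𝓘(ℝ, E) x₀ x₀) (chartCoord x₀ V))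
      = 2 * hessian f x₀ U V := by
  rw [hessian_apply, mvfderiv_christoffel, christoffelLower_apply, secondDeriv]
  set u := chartCoord x₀ U
  set v := chartCoord x₀ V
  set y₀ := extChartAt 𝓘(ℝ, E) x₀ x₀
  have hX := ((contDiffAt_chartField_grad hf x₀).differentiableAt one_ne_zero).hasFDerivAt
  have hG := ((contDiffAt_chartMetric (E := E) x₀).differentiableAt (by simp)).hasFDerivAt
  have hh := contDiffAt_comp_extChartAt_symm (n := 2) ENat.LEInfty.out hf x₀
  have heq : (fun y ↦ chartMetric x₀ y (chartField (grad f) x₀ y)) =ᶠ[𝓝 y₀]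
      fderiv ℝ (f ∘ (extChartAt 𝓘(ℝ, E) x₀).symm) := by
    filter_upwards [extChartAt_target_mem_nhds (I := 𝓘(ℝ, E)) x₀] with y hy
    exact chartMetric_chartField_grad (hf.mdifferentiable two_ne_zero) hy
  -- The product rule applied to `g(X, ·) = df`. Adding the instances `(u, v)` and `(v, u)`
  -- expresses the two terms containing `DX` by second derivatives of `f` and by first derivatives
  -- of `g`; the latter combine with `∂_X g(u, v)` to `-2 Γ(u, v)(X)`.
  have hd (a b : E) : chartMetric x₀ y₀ (fderiv ℝ (chartField (grad f) x₀) y₀ a) b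
      + fderiv ℝ (chartMetric x₀) y₀ a (chartField (grad f) x₀ y₀) b
      = fderiv ℝ (fderiv ℝ (f ∘ (extChartAt 𝓘(ℝ, E) x₀).symm)) y₀ a b := by
    rw [← heq.fderiv_eq, (hG.clm_apply hX).fderiv]
    rfl
  have hsymm := (hh.isSymmSndFDerivAt (by simp)).eq u v
  have h1 := hd u v
  have h2 := hd v u
  have h3 := chartMetric_symm x₀ y₀ u (fderiv ℝ (chartField (grad f) x₀) y₀ v)
  have h4 := fderiv_chartMetric_symm x₀ u (chartField (grad f) x₀ y₀) v
  have h5 := fderiv_chartMetric_symm x₀ v (chartField (grad f) x₀ y₀) u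
  linarith

/-- A Lie derivative of a symmetric form is symmetric, and here it is twice the Hessian. -/
theorem hessian_symm {f : M → ℝ} (hf : ContMDiff 𝓘(ℝ, E) 𝓘(ℝ, ℝ) 2 f) (x₀ : M)
    (U V : TangentSpace 𝓘(ℝ, E) x₀) : hessian f x₀ U V = hessian f x₀ V U := by
  have h1 := lieDeriv_chartMetric_grad hf x₀ U V
  have h2 := lieDeriv_chartMetric_grad hf x₀ V U
  rw [fderiv_chartMetric_symm, chartMetric_symm x₀ _ (chartCoord x₀ V),
    chartMetric_symm x₀ _ _ (chartCoord x₀ U)] at h2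
  linarith

/-- The first variation of the metric along the gradient flow. -/
theorem hasDerivAt_inner_mfderiv_flow [T2Space M] {f : M → ℝ}
    (hf : ContMDiff 𝓘(ℝ, E) 𝓘(ℝ, ℝ) 2 f) (hX : IsCompleteField (grad (E := E) f)) (x₀ : M)
    (U V : TangentSpace 𝓘(ℝ, E) x₀) :
    HasDerivAt (fun τ ↦ ⟪mfderiv 𝓘(ℝ, E) 𝓘(ℝ, E) (flow (grad f) hX τ) x₀ U,
      mfderiv 𝓘(ℝ, E) 𝓘(ℝ, E) (flow (grad f) hX τ) x₀ V⟫) (2 * hessian f x₀ U V) 0 := by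
  set y₀ := extChartAt 𝓘(ℝ, E) x₀ x₀ with hy₀
  have hflow := isMIntegralCurve_flow hX x₀
  obtain ⟨A, hA0, hA, hAe⟩ := exists_hasMFDerivAt_flow (contMDiff_grad hf) hX x₀
  let c : ℝ → E := fun τ ↦ extChartAt 𝓘(ℝ, E) x₀ (flow (grad f) hX τ x₀)
  have hc0 : c 0 = y₀ := by simp only [c, flow_zero, hy₀]
  have hc : HasDerivAt c (chartField (grad f) x₀ y₀) 0 := by
    have hs : flow (grad f) hX 0 x₀ ∈ (chartAt E x₀).source := by
      rw [flow_zero]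
      exact mem_chart_source E x₀
    have h : HasFDerivAt c (show ℝ →L[ℝ] E from _) 0 :=
      ((hasMFDerivAt_extChartAt_trivializationAt hs).comp 0 (hflow 0)).hasFDerivAt
    have h' := h.hasDerivAt
    convert h' using 1
    rw [chartField_extChartAt_self]
    change _ = (trivializationAt E (TangentSpace 𝓘(ℝ, E)) x₀).continuousLinearMapAt ℝ
      (flow (grad f) hX 0 x₀) ((1 : ℝ) • grad f (flow (grad f) hX 0 x₀))
    rw [one_smul, continuousLinearMapAt_eq_chartCoord _ (flow_zero hX x₀)]
  have hG := ((contDiffAt_chartMetric (E := E) x₀).differentiableAt (by simp)).hasFDerivAt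
  rw [← hy₀, ← hc0] at hG
  have hu (W : TangentSpace 𝓘(ℝ, E) x₀) : HasDerivAt (fun τ ↦ A τ (chartCoord x₀ W))
      (fderiv ℝ (chartField (grad f) x₀) y₀ (chartCoord x₀ W)) 0 := by
    simpa only [map_zero, add_zero] using
      hA.clm_apply (hasDerivAt_const (0 : ℝ) (chartCoord x₀ W))
  -- In the chart the inner product is `g(c τ)(A τ u, A τ v)`. With `c' = X` and `A' = DX` at `0`,
  -- the three terms of the product rule are those of the Lie derivative.
  have hd := hasDerivAt_bilin_apply hG hc (hu U) (hu V)
  have hval := lieDeriv_chartMetric_grad hf x₀ U V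
  rw [← hy₀] at hval
  rw [hc0, hA0] at hd
  simp only [ContinuousLinearMap.id_apply] at hd
  rw [hval] at hd
  refine hd.congr_of_eventuallyEq ?_
  have hsrc : ∀ᶠ τ in 𝓝 (0 : ℝ), flow (grad f) hX τ x₀ ∈ (extChartAt 𝓘(ℝ, E) x₀).source := by
    refine hflow.continuous.continuousAt.eventually_mem ?_
    rw [flow_zero]
    exact extChartAt_source_mem_nhds x₀
  filter_upwards [hAe, hsrc] with τ hτ hs
  rw [hτ.mfderiv, chartMetric_extChartAt hs]
  rfl

end Hessian

end GradFlow

namespace GradFlow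

/-! ### Evolution of Gram determinants along the flow -/

section Determinant

/-- Jacobi's formula at the identity. -/
theorem hasDerivAt_det_of_eq_one {k : ℕ} {A : ℝ → Matrix (Fin k) (Fin k) ℝ}
    {B : Matrix (Fin k) (Fin k) ℝ} {t : ℝ} (hA : ∀ i j, HasDerivAt (fun s ↦ A s i j) (B i j) t)
    (h1 : A t = 1) : HasDerivAt (fun s ↦ (A s).det) B.trace t := by
  simp_rw [Matrix.det_apply]
  have h := HasDerivAt.fun_sum (u := Finset.univ) fun (σ : Equiv.Perm (Fin k)) _ ↦
    ((HasDerivAt.fun_finsetProd (u := Finset.univ) fun i _ ↦ hA (σ i) i).const_smul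
      (Equiv.Perm.sign σ))
  refine h.congr_deriv ?_
  rw [Finset.sum_eq_single 1]
  · simp [h1, Matrix.trace, Finset.prod_eq_one]
  · intro σ _ hσ
    rw [Finset.sum_eq_zero, smul_zero]
    intro i _
    -- A nontrivial permutation moves at least two points. Besides the differentiated factor `i`,
    -- some off-diagonal entry of the identity thus remains and kills the term.
    obtain ⟨j, hji, hj⟩ : ∃ j, j ≠ i ∧ σ j ≠ j := by
      by_contra! h
      refine hσ (Equiv.ext fun j ↦ ?_)
      by_cases hji : j = i
      · by_contra hj
        have h2 := h (σ j) (fun h3 ↦ hj (h3.trans hji.symm))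
        exact hj (σ.injective h2)
      · exact h j hji
    rw [Finset.prod_eq_zero (i := j) (by simp [hji]) (by simp [h1, hj]), zero_smul]
  · simp

end Determinant

section VolumeDistortion

open Set Filter Topology

variable {E : Type*} [NormedAddCommGroup E] [NormedSpace ℝ E]
  {M : Type*} [TopologicalSpace M] [ChartedSpace E M]
  [RiemannianBundle (fun x : M ↦ TangentSpace 𝓘(ℝ, E) x)]

/-- The Gram matrix of the images of tangent vectors under the derivative of a map. -/
noncomputable def pullbackGram {k : ℕ} (h : M → M) (x : M) (v : Fin k → TangentSpace 𝓘(ℝ, E) x) :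
    Matrix (Fin k) (Fin k) ℝ :=
  Matrix.gram ℝ fun i ↦ mfderiv 𝓘(ℝ, E) 𝓘(ℝ, E) h x (v i)

theorem pullbackGram_id {k : ℕ} {h : M → M} (hh : h = id) (x : M)
    (v : Fin k → TangentSpace 𝓘(ℝ, E) x) : pullbackGram h x v = Matrix.gram ℝ v := by
  subst hh
  simp only [pullbackGram, mfderiv_id]
  rfl

theorem pullbackGram_comp {k : ℕ} {g h : M → M} {x : M}
    (hg : MDifferentiableAt 𝓘(ℝ, E) 𝓘(ℝ, E) g (h x)) (hh : MDifferentiableAt 𝓘(ℝ, E) 𝓘(ℝ, E) h x)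
    (v : Fin k → TangentSpace 𝓘(ℝ, E) x) :
    pullbackGram (g ∘ h) x v
      = pullbackGram g (h x) fun i ↦ mfderiv 𝓘(ℝ, E) 𝓘(ℝ, E) h x (v i) := by
  simp only [pullbackGram, mfderiv_comp x hg hh]
  rfl

theorem det_pullbackGram_eq_zero {k : ℕ} {x : M} {v : Fin k → TangentSpace 𝓘(ℝ, E) x}
    (hv : ¬LinearIndependent ℝ v) (h : M → M) : (pullbackGram h x v).det = 0 :=
  det_gram_eq_zero_of_not_linearIndependent hv (mfderiv 𝓘(ℝ, E) 𝓘(ℝ, E) h x).toLinearMap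

theorem det_pullbackGram_sum_smul {k : ℕ} {x : M} (P : Matrix (Fin k) (Fin k) ℝ)
    (e : Fin k → TangentSpace 𝓘(ℝ, E) x) (h : M → M) :
    (pullbackGram h x fun i ↦ ∑ j, P i j • e j).det = P.det ^ 2 * (pullbackGram h x e).det :=
  det_gram_map_sum_smul P e (mfderiv 𝓘(ℝ, E) 𝓘(ℝ, E) h x).toLinearMap

variable [FiniteDimensional ℝ E] [T2Space M] [IsManifold 𝓘(ℝ, E) ∞ M]
  [IsContMDiffRiemannianBundle 𝓘(ℝ, E) ∞ E (fun x : M ↦ TangentSpace 𝓘(ℝ, E) x)]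
  {f : M → ℝ}

/-- Arbitrary tuples are allowed because the flow does not keep a frame orthonormal. An independent
tuple reduces to an orthonormal frame, where Jacobi's formula and Ky Fan's inequality apply; for a
dependent one the determinant vanishes identically. -/
theorem exists_hasDerivAt_det_pullbackGram_zero (hf : ContMDiff 𝓘(ℝ, E) 𝓘(ℝ, ℝ) 2 f)
    (hX : IsCompleteField (grad (E := E) f)) {k : ℕ} (hk : 1 ≤ k) {ε : ℝ} {x : M}
    (hε : ε ≤ traceK k (hessian (E := E) f x)) (v : Fin k → TangentSpace 𝓘(ℝ, E) x) :
    ∃ d, HasDerivAt (fun t ↦ (pullbackGram (flow (grad f) hX t) x v).det) d 0 ∧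
      2 * ε * (Matrix.gram ℝ v).det ≤ d := by
  by_cases hv : LinearIndependent ℝ v
  · obtain ⟨e, P, he, rfl⟩ := exists_orthonormal_sum_smul hv
    have h1 : pullbackGram (flow (grad f) hX 0) x e = 1 :=
      (pullbackGram_id (funext (flow_zero hX)) x e).trans
        (Matrix.gram_eq_one_iff_orthonormal.2 he)
    have h2 := (hasDerivAt_det_of_eq_one
      (A := fun t ↦ pullbackGram (flow (grad f) hX t) x e)
      (B := Matrix.of fun i j ↦ 2 * hessian f x (e i) (e j))
      (fun i j ↦ hasDerivAt_inner_mfderiv_flow hf hX x (e i) (e j)) h1).const_mul (P.det ^ 2)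
    refine ⟨_, h2.congr_of_eventuallyEq (.of_forall fun t ↦ det_pullbackGram_sum_smul P e _), ?_⟩
    rw [det_gram_sum_smul, Matrix.gram_eq_one_iff_orthonormal.2 he, Matrix.det_one, mul_one,
      mul_comm]
    refine mul_le_mul_of_nonneg_left ?_ (sq_nonneg _)
    have h3 := hε.trans (traceK_le_sum _ (hessian_symm hf x) hk he)
    simpa only [Matrix.trace, Matrix.diag_apply, Matrix.of_apply, ← Finset.mul_sum] using
      mul_le_mul_of_nonneg_left h3 zero_le_two
  · refine ⟨0, ?_, ?_⟩
    · simp only [det_pullbackGram_eq_zero hv]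
      exact hasDerivAt_const _ _
    · have := det_gram_eq_zero_of_not_linearIndependent hv LinearMap.id
      simp only [LinearMap.id_apply] at this
      rw [this, mul_zero]

/-- Since `φ_s = φ_{s-t} ∘ φ_t`, this is the estimate at time zero for the tuple transported to
`φ_t(x)`. -/
theorem exists_hasDerivAt_det_pullbackGram (hf : ContMDiff 𝓘(ℝ, E) 𝓘(ℝ, ℝ) 2 f)
    (hX : IsCompleteField (grad (E := E) f)) {k : ℕ} (hk : 1 ≤ k) {ε : ℝ}
    (hε : ∀ x, ε ≤ traceK k (hessian (E := E) f x)) (x : M)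
    (v : Fin k → TangentSpace 𝓘(ℝ, E) x) (t : ℝ) :
    ∃ d, HasDerivAt (fun t ↦ (pullbackGram (flow (grad f) hX t) x v).det) d t ∧
      2 * ε * (pullbackGram (flow (grad f) hX t) x v).det ≤ d := by
  have hXs := contMDiff_grad hf
  have hdiff (s : ℝ) : MDifferentiable 𝓘(ℝ, E) 𝓘(ℝ, E) (flow (grad f) hX s) :=
    (contMDiff_flow hXs hX s).mdifferentiable one_ne_zero
  obtain ⟨d, hd, hdε⟩ := exists_hasDerivAt_det_pullbackGram_zero hf hX hk
    (hε (flow (grad f) hX t x)) fun i ↦ mfderiv 𝓘(ℝ, E) 𝓘(ℝ, E) (flow (grad f) hX t) x (v i)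
  refine ⟨d, ?_, hdε⟩
  rw [← sub_self t] at hd
  refine (hd.comp_sub_const t t).congr_of_eventuallyEq (.of_forall fun s ↦ ?_)
  have h : flow (grad f) hX s = flow (grad f) hX (s - t) ∘ flow (grad f) hX t :=
    funext fun y ↦ by rw [Function.comp_apply, ← flow_add hXs, sub_add_cancel]
  simp only
  rw [h, pullbackGram_comp (hdiff _ _) (hdiff _ _)]

theorem det_pullbackGram_flow_neg_le (hf : ContMDiff 𝓘(ℝ, E) 𝓘(ℝ, ℝ) 2 f)
    (hX : IsCompleteField (grad (E := E) f)) {k : ℕ} (hk : 1 ≤ k) {ε : ℝ}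
    (hε : ∀ x, ε ≤ traceK k (hessian (E := E) f x)) (x : M)
    (v : Fin k → TangentSpace 𝓘(ℝ, E) x) {t : ℝ} (ht : 0 ≤ t) :
    (pullbackGram (flow (grad f) hX (-t)) x v).det
      ≤ Real.exp (-(ε * t)) ^ 2 * (Matrix.gram ℝ v).det := by
  choose d hd hdε using exists_hasDerivAt_det_pullbackGram hf hX hk hε x v
  set D : ℝ → ℝ := fun t ↦ (pullbackGram (flow (grad f) hX t) x v).det
  have hexp (s : ℝ) : HasDerivAt (fun s ↦ Real.exp (-(2 * ε) * s))
      (Real.exp (-(2 * ε) * s) * -(2 * ε)) s := by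
    simpa using ((hasDerivAt_id s).const_mul (-(2 * ε))).exp
  -- Grönwall's argument with an integrating factor; the sign of `ε` plays no role.
  have hmono : Monotone fun s ↦ D s * Real.exp (-(2 * ε) * s) := by
    refine monotone_of_hasDerivAt_nonneg (fun s ↦ (hd s).mul (hexp s)) fun s ↦ ?_
    have h1 : 0 ≤ (d s - 2 * ε * D s) * Real.exp (-(2 * ε) * s) :=
      mul_nonneg (sub_nonneg.2 (hdε s)) (Real.exp_pos _).le
    simp only [Pi.zero_apply]
    linarith
  have h := hmono (neg_nonpos.2 ht)
  have h0 : D 0 = (Matrix.gram ℝ v).det := by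
    simp only [D, pullbackGram_id (funext (flow_zero hX)) x v]
  simp only [mul_zero, Real.exp_zero, mul_one, h0] at h
  rw [← Real.exp_nat_mul]
  calc D (-t) = Real.exp (↑2 * -(ε * t)) * (D (-t) * Real.exp (-(2 * ε) * -t)) := by
        rw [mul_left_comm, ← Real.exp_add]
        ring_nf
        simp
    _ ≤ _ := mul_le_mul_of_nonneg_left h (Real.exp_pos _).le

theorem norm_ιMulti_mfderiv_flow_neg_le (hf : ContMDiff 𝓘(ℝ, E) 𝓘(ℝ, ℝ) 2 f)
    (hX : IsCompleteField (grad (E := E) f)) {k : ℕ} (hk : 1 ≤ k) {ε : ℝ}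
    (hε : ∀ x, ε ≤ traceK k (hessian (E := E) f x)) (x : M)
    {e : Fin k → TangentSpace 𝓘(ℝ, E) x} (he : Orthonormal ℝ e) {t : ℝ} (ht : 0 ≤ t) :
    ‖exteriorPower.ιMulti ℝ k
      fun i ↦ mfderiv 𝓘(ℝ, E) 𝓘(ℝ, E) (flow (grad f) hX (-t)) x (e i)‖ ≤ Real.exp (-(ε * t)) := by
  refine abs_le_of_sq_le_sq' ?_ (Real.exp_pos _).le |>.2
  rw [norm_ιMulti_sq]
  have := det_pullbackGram_flow_neg_le hf hX hk hε x e ht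
  rwa [Matrix.gram_eq_one_iff_orthonormal.2 he, Matrix.det_one, mul_one] at this

end VolumeDistortion

/-! ### From the Jacobian to volumes of surfaces, and the theorem -/

section Volume

variable {F : Type*} [NormedAddCommGroup F] [NormedSpace ℝ F] [FiniteDimensional ℝ F]
  {N : Type*} [TopologicalSpace N] [ChartedSpace F N]
  [RiemannianBundle (fun x : N ↦ TangentSpace 𝓘(ℝ, F) x)]

/-- A map that contracts `k`-volume infinitesimally contracts the `k`-volume of `k`-surfaces. -/
theorem volumeK_comp_le {k : ℕ} {h : N → N} (hh : MDifferentiable 𝓘(ℝ, F) 𝓘(ℝ, F) h) {c : ℝ}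
    (hc : 0 ≤ c) (hbound : ∀ (x : N) (e : Fin k → TangentSpace 𝓘(ℝ, F) x), Orthonormal ℝ e →
      ‖exteriorPower.ιMulti ℝ k fun i ↦ mfderiv 𝓘(ℝ, F) 𝓘(ℝ, F) h x (e i)‖ ≤ c)
    {D : Set (EuclideanSpace ℝ (Fin k))} (hD : IsOpen D) {σ : EuclideanSpace ℝ (Fin k) → N}
    (hσ : ContMDiffOn 𝓘(ℝ, EuclideanSpace ℝ (Fin k)) 𝓘(ℝ, F) 1 σ D) :
    volumeK (F := F) k D (h ∘ σ) ≤ ENNReal.ofReal c * volumeK (F := F) k D σ := by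
  -- Finiteness of the constant lets it enter the integral with no measurability of the Jacobian.
  rw [volumeK, volumeK, ← lintegral_const_mul' _ _ ENNReal.ofReal_ne_top]
  refine setLIntegral_mono' hD.measurableSet fun u hu ↦ ?_
  rw [← ENNReal.ofReal_mul hc]
  refine ENNReal.ofReal_le_ofReal ?_
  have hσu : MDifferentiableAt 𝓘(ℝ, EuclideanSpace ℝ (Fin k)) 𝓘(ℝ, F) σ u :=
    (hσ.contMDiffAt (hD.mem_nhds hu)).mdifferentiableAt one_ne_zero
  have hnonneg : 0 ≤ jacobianK (E := EuclideanSpace ℝ (Fin k)) (F := F) k σ u :=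
    Real.iSup_nonneg fun e ↦ norm_nonneg _
  refine Real.iSup_le (fun e ↦ ?_) (mul_nonneg hc hnonneg)
  rw [mfderiv_comp u (hh _) hσu]
  refine (norm_ιMulti_map_le (mfderiv 𝓘(ℝ, F) 𝓘(ℝ, F) h (σ u)).toLinearMap hc (hbound (σ u))
    _).trans (mul_le_mul_of_nonneg_left ?_ hc)
  -- Boundedness is essential: an unbounded real supremum has the default value `0`.
  exact le_ciSup (bddAbove_norm_ιMulti_map k
    (mfderiv 𝓘(ℝ, EuclideanSpace ℝ (Fin k)) 𝓘(ℝ, F) σ u).toLinearMap) e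

end Volume

end GradFlow

theorem mainTheorem2
    {E : Type*} [NormedAddCommGroup E] [NormedSpace ℝ E] [FiniteDimensional ℝ E]
    {M : Type*} [TopologicalSpace M] [T2Space M] [ChartedSpace E M] [IsManifold 𝓘(ℝ, E) ∞ M]
    [RiemannianBundle (fun x : M ↦ TangentSpace 𝓘(ℝ, E) x)]
    [IsContMDiffRiemannianBundle 𝓘(ℝ, E) ∞ E (fun x : M ↦ TangentSpace 𝓘(ℝ, E) x)]
    (f : M → ℝ) (hf : ContMDiff 𝓘(ℝ, E) 𝓘(ℝ, ℝ) 2 f)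
    (hX : GradFlow.IsCompleteField (GradFlow.grad (E := E) f))
    (k : ℕ) (hk : 1 ≤ k) (hkn : k ≤ Module.finrank ℝ E)
    (ε : ℝ) (hε : ∀ x : M, ε ≤ GradFlow.traceK k (GradFlow.hessian (E := E) f x)) :
    -- the maps `φ_t` form a one-parameter group of `C¹` diffeomorphisms
    (∀ t : ℝ, ContMDiff 𝓘(ℝ, E) 𝓘(ℝ, E) 1 (GradFlow.flow (GradFlow.grad (E := E) f) hX t)) ∧
    (∀ x : M, GradFlow.flow (GradFlow.grad (E := E) f) hX 0 x = x) ∧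
    (∀ (s t : ℝ) (x : M), GradFlow.flow (GradFlow.grad (E := E) f) hX (s + t) x
      = GradFlow.flow (GradFlow.grad (E := E) f) hX s
          (GradFlow.flow (GradFlow.grad (E := E) f) hX t x)) ∧
    -- the bound on the `k`-Jacobian
    (∀ (t : ℝ) (x : M), 0 < t →
      GradFlow.jacobianK (E := E) (F := E) k
        (GradFlow.flow (GradFlow.grad (E := E) f) hX (-t)) x ≤ Real.exp (-(ε * t))) ∧
    -- expansion and contraction of `k`-volume
    (0 < ε →
      GradFlow.ExpandsVolumeExponentially (F := E) k ε
        (fun t ↦ GradFlow.flow (GradFlow.grad (E := E) f) hX t) ∧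
      GradFlow.ContractsVolumeExponentially (F := E) k ε
        (fun t ↦ GradFlow.flow (GradFlow.grad (E := E) f) hX (-t))) := by
  have hXs := GradFlow.contMDiff_grad hf
  have hC1 := GradFlow.contMDiff_flow hXs hX
  have hbound (t : ℝ) (ht : 0 < t) (x : M) (e : Fin k → TangentSpace 𝓘(ℝ, E) x)
      (he : Orthonormal ℝ e) := GradFlow.norm_ιMulti_mfderiv_flow_neg_le hf hX hk hε x he ht.le
  have hcontract (t : ℝ) (ht : 0 < t) (D : Set (EuclideanSpace ℝ (Fin k)))
      (σ : EuclideanSpace ℝ (Fin k) → M) (hD : IsOpen D)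
      (hσ : ContMDiffOn 𝓘(ℝ, EuclideanSpace ℝ (Fin k)) 𝓘(ℝ, E) 1 σ D) :=
    GradFlow.volumeK_comp_le ((hC1 (-t)).mdifferentiable one_ne_zero) (Real.exp_pos _).le
      (hbound t ht) hD hσ
  refine ⟨hC1, GradFlow.flow_zero hX, GradFlow.flow_add hXs hX, fun t x ht ↦ ?_,
    fun hε0 ↦ ⟨⟨hε0, fun t ht D σ hD hσ ↦ ?_⟩, hε0, hcontract⟩⟩
  · exact Real.iSup_le (fun e ↦ hbound t ht x e.1 e.2) (Real.exp_pos _).le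
  -- Contraction is applied to `φ_t ∘ σ`, which `φ_{-t}` carries back to `σ`; multiplying by
  -- `e^{εt}` then gives the expansion.
  · have h := hcontract t ht D _ hD ((hC1 t).comp_contMDiffOn hσ)
    rw [← Function.comp_assoc, show GradFlow.flow (GradFlow.grad f) hX (-t) ∘
      GradFlow.flow (GradFlow.grad f) hX t = id from funext fun x ↦ by
        rw [Function.comp_apply, ← GradFlow.flow_add hXs, neg_add_cancel, GradFlow.flow_zero]; rfl,
      Function.id_comp] at h
    refine (mul_le_mul_right h _).trans_eq ?_
    rw [← mul_assoc, ← ENNReal.ofReal_mul (Real.exp_pos _).le, ← Real.exp_add, add_neg_cancel,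
      Real.exp_zero, ENNReal.ofReal_one, one_mul]
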